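/- Let $\kappa$ be a field, let $X$ be a compact ANR (absolute neighborhood retract for metrizable spaces), and let $\omega$ be a topological closed 1-form on $X$, that is, an equivalence class of systems $\{(U_\alpha,f_\alpha)\}$ in which the $U_\alpha$ are open and cover $X$, the functions $f_\alpha:U_\alpha\to\mathbb R$ are continuous, and each $f_\alpha-f_\beta$ is locally constant on $U_\alpha\cap U_\beta$; two systems are equivalent if their union is again such a system. Integration of $\omega$ along paths defines a homomorphism $\xi(\omega):H_1(X;\mathbb Z)\to\mathbb R$; let $\Gamma\subset\mathbb R$ be its image. Let $p:\tilde X\to X$ be the associated principal $\Gamma$-covering: the quotient map of a free, properly discontinuous action of $\Gamma$ on $\tilde X$ such that any path in $\tilde X$ over a loop $\gamma$ in $X$ ends at the translate of its starting point by $\int_\gamma\omega\in\Gamma$. Let $f:\tilde X\to\mathbb R$ be a lift of $\omega$: a continuous map such that $f(g\cdot x)=f(x)+g$ for all $g\in\Gamma$, $x\in\tilde X$, and such that $f-f_\alpha\circ p$ is locally constant on $p^{-1}(U_\alpha)$ for all $\alpha$, where $\{(U_\alpha,f_\alpha)\}$ represents $\omega$. For an integer $r\ge 0$ let $H_r$ denote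 singular homology with coefficients in $\kappa$; the action of $\Gamma$ on $\tilde X$ makes $H_r(\tilde X)$ a $\kappa[\Gamma]$-module. Let $\operatorname{Tor}H_r(\tilde X)$ be its $\kappa[\Gamma]$-torsion submodule, and for $t\in\mathbb R$ put $$\mathbb I_t(r)=\operatorname{im}\bigl(H_r(\{x\in\tilde X: f(x)\le t\})\to H_r(\tilde X)\bigr),\qquad \mathbb I^t(r)=\operatorname{im}\bigl(H_r(\{x\in\tilde X: f(x)\ge t\})\to H_r(\tilde X)\bigr).$$ Then, for every $r\ge 0$, $$\operatorname{Tor}H_r(\tilde X)=\bigcap_{t\in\mathbb R}\mathbb I_t(r)\qquad\text{and}\qquad \operatorname{Tor}H_r(\tilde X)=\bigcap_{t\in\mathbb R}\mathbb I^t(r).$$ -/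

import Mathlib

open CategoryTheory Topology

universe u v

noncomputable section

/-! ### Absolute neighborhood retracts -/

/-- A (metrizable) absolute neighborhood retract: whenever `X` is embedded as a closed subset of a
metrizable space `Y`, some open neighborhood `U` of the image retracts onto it. -/
structure IsANR (X : Type u) [TopologicalSpace X] : Prop where
  metrizable : TopologicalSpace.MetrizableSpace X
  exists_retraction : ∀ (Y : Type u) [TopologicalSpace Y] [TopologicalSpace.MetrizableSpace Y]
    (i : X → Y), IsClosedEmbedding i →
      ∃ (U : Set Y) (hU : Set.range i ⊆ U), IsOpen U ∧
        ∃ r : C(U, X), ∀ x : X, r ⟨i x, hU ⟨x, rfl⟩⟩ = x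

/-! ### Topological closed one-forms -/

/-- `f - g` is locally constant on the open set `W`. -/
def LocallyConstDiffOn {X : Type u} [TopologicalSpace X] (f g : X → ℝ) (W : Set X) : Prop :=
  ∀ x ∈ W, ∀ᶠ y in 𝓝 x, f y - g y = f x - g x

/-- A multi-valued map on `X`: a family of pairs `(U, h)`, where the `U` are open and cover `X`,
`h` is a continuous real-valued function on `U` (only its values on `U` are ever used), and
any two of the functions differ by a locally constant function where both are defined. -/
structure MultivaluedMap (X : Type u) [TopologicalSpace X] where
  charts : Set (Set X × (X → ℝ))
  isOpen : ∀ c ∈ charts, IsOpen c.1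
  continuousOn : ∀ c ∈ charts, ContinuousOn c.2 c.1
  covers : ∀ x : X, ∃ c ∈ charts, x ∈ c.1
  compatible : ∀ c ∈ charts, ∀ d ∈ charts, LocallyConstDiffOn c.2 d.2 (c.1 ∩ d.1)

namespace MultivaluedMap

variable {X : Type u} [TopologicalSpace X]

/-- Two multi-valued maps are equivalent if their union is still a multi-valued map. -/
def Equivalent (m n : MultivaluedMap X) : Prop :=
  ∀ c ∈ m.charts, ∀ d ∈ n.charts, LocallyConstDiffOn c.2 d.2 (c.1 ∩ d.1)

theorem Equivalent.symm {m n : MultivaluedMap X} (h : m.Equivalent n) : n.Equivalent m := by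
  intro c hc d hd x hx
  filter_upwards [h d hd c hc x hx.symm] with y hy
  linarith

theorem Equivalent.trans {m n k : MultivaluedMap X} (h : m.Equivalent n) (h' : n.Equivalent k) :
    m.Equivalent k := by
  intro c hc d hd x hx
  obtain ⟨e, he, hxe⟩ := n.covers x
  filter_upwards [h c hc e he x ⟨hx.1, hxe⟩, h' e he d hd x ⟨hxe, hx.2⟩] with y hy hy'
  linarith

instance setoid (X : Type u) [TopologicalSpace X] : Setoid (MultivaluedMap X) where
  r := Equivalent
  iseqv := ⟨fun m => m.compatible, Equivalent.symm, Equivalent.trans⟩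

/-- `F : Y → ℝ` is a primitive of the pullback of `m` along `φ : Y → X`: for every `(U, h)` in `m`
the difference `F - h ∘ φ` is locally constant on `φ ⁻¹' U`. -/
def IsPrimitive {Y : Type v} [TopologicalSpace Y] (φ : C(Y, X)) (F : Y → ℝ)
    (m : MultivaluedMap X) : Prop :=
  ∀ c ∈ m.charts, LocallyConstDiffOn F (c.2 ∘ φ) (φ ⁻¹' c.1)

theorem IsPrimitive.of_equivalent {Y : Type v} [TopologicalSpace Y] {φ : C(Y, X)} {F : Y → ℝ}
    {m n : MultivaluedMap X} (h : m.Equivalent n) (hF : IsPrimitive φ F m) :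
    IsPrimitive φ F n := by
  intro d hd y hy
  obtain ⟨c, hc, hyc⟩ := m.covers (φ y)
  have h1 := φ.continuous.continuousAt.eventually (h c hc d hd (φ y) ⟨hyc, hy⟩)
  filter_upwards [hF c hc y hyc, h1] with z hz hz'
  simp only [Function.comp_apply] at hz hz' ⊢
  linarith

end MultivaluedMap

/-- A topological closed one-form (TC1-form): an equivalence class of multi-valued maps. -/
def TC1Form (X : Type u) [TopologicalSpace X] : Type u :=
  Quotient (MultivaluedMap.setoid X)

namespace TC1Form

variable {X : Type u} [TopologicalSpace X]

/-- `F : Y → ℝ` is a primitive of the pullback of the TC1-form `ω` along `φ : Y → X`. -/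
def IsPrimitive (ω : TC1Form X) {Y : Type v} [TopologicalSpace Y] (φ : C(Y, X)) (F : Y → ℝ) :
    Prop :=
  Quotient.lift (MultivaluedMap.IsPrimitive φ F)
    (fun _ _ h => propext
      ⟨MultivaluedMap.IsPrimitive.of_equivalent h, MultivaluedMap.IsPrimitive.of_equivalent h.symm⟩)
    ω

/-- `∫_γ ω = c`: the total variation along `γ` of a primitive of `ω` along `γ`. (Along a piece
of `γ` inside a chart `(U, h)` a primitive changes exactly as `h ∘ γ` does.) -/
def HasIntegral (ω : TC1Form X) (γ : C(unitInterval, X)) (c : ℝ) : Prop :=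
  ∃ F : unitInterval → ℝ, ω.IsPrimitive γ F ∧ F 1 - F 0 = c

/-- The group `Γ ⊆ ℝ` of `ω`: the image of the homomorphism `ξ(ω) : H₁(X; ℤ) → ℝ` given by
integrating `ω`. As `H₁(X; ℤ)` is generated by the classes of loops, it is the subgroup of `ℝ`
generated by the integrals of `ω` along loops. -/
def periods (ω : TC1Form X) : AddSubgroup ℝ :=
  AddSubgroup.closure {c | ∃ (x : X) (γ : Path x x), ω.HasIntegral γ.toContinuousMap c}

theorem mem_periods {ω : TC1Form X} {x : X} {γ : Path x x} {c : ℝ}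
    (h : ω.HasIntegral γ.toContinuousMap c) : c ∈ ω.periods :=
  AddSubgroup.subset_closure ⟨x, γ, h⟩

variable {E : Type u} [TopologicalSpace E]

/-- `p : E → X` is the principal `Γ`-covering associated with the class of `ω`: a covering which is
the quotient map of a free (properly discontinuous) action of `Γ`, such that a path in `E` over a
loop `γ` of `X` ends at the translate of its starting point by `∫_γ ω`. -/
structure IsAssociatedCovering (ω : TC1Form X) [AddAction ω.periods E] (p : C(E, X)) : Prop where
  isAddQuotientCoveringMap : IsAddQuotientCoveringMap p ω.periods
  monodromy : ∀ (x : X) (γ : Path x x) (c : ℝ) (h : ω.HasIntegral γ.toContinuousMap c)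
    (σ : C(unitInterval, E)), (∀ s, p (σ s) = γ s) →
      σ 1 = (⟨c, mem_periods h⟩ : ω.periods) +ᵥ σ 0

/-- `f : E → ℝ` is a lift of `ω` to the covering `p : E → X`: a continuous `Γ`-equivariant map
which is a primitive of the pullback of `ω`. -/
structure IsLift (ω : TC1Form X) [AddAction ω.periods E] (p : C(E, X)) (f : E → ℝ) : Prop where
  continuous : Continuous f
  equivariant : ∀ (g : ω.periods) (e : E), f (g +ᵥ e) = f e + (g : ℝ)
  isPrimitive : ω.IsPrimitive p f

end TC1Form

/-! ### Homology of a space with a group action -/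

/-- The singular homology functor `H_r(-; κ)`. -/
abbrev homologyFunctor (κ : Type u) [Field κ] (r : ℕ) : TopCat.{u} ⥤ ModuleCat.{u} κ :=
  (AlgebraicTopology.singularHomologyFunctor (ModuleCat.{u} κ) r).obj (ModuleCat.of κ κ)

/-- The singular homology `H_r(E; κ)`. -/
abbrev Homology (κ : Type u) [Field κ] (r : ℕ) (E : Type u) [TopologicalSpace E] : Type u :=
  ((homologyFunctor κ r).obj (TopCat.of E) : ModuleCat.{u} κ)

/-- The linear map induced in homology by a continuous map. -/
def homologyMap (κ : Type u) [Field κ] (r : ℕ) {A E : Type u} [TopologicalSpace A]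
    [TopologicalSpace E] (φ : C(A, E)) : Homology κ r A →ₗ[κ] Homology κ r E :=
  ((homologyFunctor κ r).map (TopCat.ofHom φ)).hom

theorem homologyMap_id (κ : Type u) [Field κ] (r : ℕ) (E : Type u) [TopologicalSpace E] :
    homologyMap κ r (ContinuousMap.id E) = LinearMap.id := by
  unfold homologyMap
  rw [TopCat.ofHom_id, CategoryTheory.Functor.map_id]
  rfl

theorem homologyMap_comp (κ : Type u) [Field κ] (r : ℕ) {A B E : Type u} [TopologicalSpace A]
    [TopologicalSpace B] [TopologicalSpace E] (ψ : C(B, E)) (φ : C(A, B)) :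
    homologyMap κ r (ψ.comp φ) = (homologyMap κ r ψ).comp (homologyMap κ r φ) := by
  unfold homologyMap
  rw [TopCat.ofHom_comp, CategoryTheory.Functor.map_comp]
  rfl

/-- The image of `H_r(S; κ) → H_r(E; κ)` for a subspace `S` of `E`. -/
def homologyImage (κ : Type u) [Field κ] (r : ℕ) {E : Type u} [TopologicalSpace E] (S : Set E) :
    Submodule κ (Homology κ r E) :=
  LinearMap.range (homologyMap κ r (⟨Subtype.val, continuous_subtype_val⟩ : C(S, E)))

/-- `𝕀_t(r)`, the image of the homology of the sublevel set `{f ≤ t}`. -/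
def sublevelImage (κ : Type u) [Field κ] (r : ℕ) {E : Type u} [TopologicalSpace E] (f : E → ℝ)
    (t : ℝ) : Submodule κ (Homology κ r E) :=
  homologyImage κ r {e | f e ≤ t}

/-- `𝕀^t(r)`, the image of the homology of the superlevel set `{f ≥ t}`. -/
def superlevelImage (κ : Type u) [Field κ] (r : ℕ) {E : Type u} [TopologicalSpace E] (f : E → ℝ)
    (t : ℝ) : Submodule κ (Homology κ r E) :=
  homologyImage κ r {e | t ≤ f e}

section GroupRing

variable (κ : Type u) [Field κ] (r : ℕ) (G : Type v) [AddCommGroup G]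
  (E : Type u) [TopologicalSpace E] [AddAction G E] [ContinuousConstVAdd G E]

/-- Translation by `g` on `E`. -/
def translation (g : G) : C(E, E) := ⟨fun e => g +ᵥ e, continuous_const_vadd g⟩

/-- The action of `G` on `H_r(E; κ)` by the isomorphisms induced by the translations. -/
def homologyAction : Multiplicative G →* Module.End κ (Homology κ r E) where
  toFun g := homologyMap κ r (translation G E g.toAdd)
  map_one' := by
    have h : translation G E (Multiplicative.toAdd 1) = ContinuousMap.id E := by
      ext e; simp [translation]
    rw [h, homologyMap_id]
    rfl
  map_mul' g h := by
    have e : translation G E (g * h).toAdd =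
        (translation G E g.toAdd).comp (translation G E h.toAdd) := by
      ext e; simp [translation, add_vadd]
    rw [e, homologyMap_comp]
    rfl

/-- The `κ[G]`-module structure on `H_r(E; κ)`, in which `(∑ aᵢ gᵢ) • x = ∑ aᵢ ⟨gᵢ⟩ x`. -/
instance homologyModule : Module (AddMonoidAlgebra κ G) (Homology κ r E) :=
  Module.compHom _
    (AddMonoidAlgebra.lift κ (Module.End κ (Homology κ r E)) G (homologyAction κ r G E)).toRingHom

theorem homologyModule_single_smul (g : G) (a : κ) (x : Homology κ r E) :
    (AddMonoidAlgebra.single g a : AddMonoidAlgebra κ G) • x =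
      a • homologyMap κ r (translation G E g) x := by
  change (AddMonoidAlgebra.lift κ (Module.End κ (Homology κ r E)) G (homologyAction κ r G E))
    (AddMonoidAlgebra.single g a) x = _
  rw [AddMonoidAlgebra.lift_single]
  rfl

end GroupRing

end

/-! The map `f` shifts by `χ g` under translation by `g`, where `χ` is the inclusion of Γ in ℝ. So
the action of κ[Γ] respects two filtrations: by degree on κ[Γ] and by sublevel sets on homology.

Torsion lies in every sublevel image (`mem_sublevelImage_of_smul_eq_zero`): if `a • y = 0` with `a ≠
0`, solving for the leading term of `a` writes `y` as a combination of translates of itself, all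
shifted down by at least a fixed `ε > 0`. A class lives in some sublevel set because its chains are
compact, and iterating the relation pushes it below every level.

Conversely, let `y` come from every sublevel set. Compactness and the ANR property give finitely
many simplices `L q` of the covering and a constant `C` such that every cycle in `{f ≤ t}` is
homologous to a combination of translates of the `L q` that lie at height at most `t + C`, measured
at one vertex (`exists_finite_simplices`). To see this, embed `X` in a normed space with a
neighborhood retraction, subdivide, push the vertices to a finite net, and lift the retracted
straight-line homotopies. These are compatible with faces, and each stays in one sheet, where `f`
varies by less than 2. Hence `y` is represented by vectors of arbitrarily negative degree in the
free module κ[Γ]^Q, and any two of them differ by an element of the submodule `B` of vectors with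
null-homologous chain. If no nonzero multiple of such a vector were in `B`, linear algebra over the
fraction field would give a κ[Γ]-linear functional that kills `B` but not the vector. Its value
would have arbitrarily negative degree, hence be zero
(`AddMonoidAlgebra.exists_smul_mem_of_forall_degreeLE`). So `y` is torsion.

The superlevel statement is the same result for `-f` and `-χ`. -/

noncomputable section

/-! ### The augmented chain complex of tuples -/

/-- Formal linear combinations of `n`-tuples in `K`. -/
abbrev TupleChain (κ : Type*) [CommRing κ] (n : ℕ) (K : Type*) := (Fin n → K) →₀ κ

namespace TupleChain

variable {κ : Type*} [CommRing κ] {K K' : Type*}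

/-- The alternating sum of the faces of a tuple. -/
def boundary (κ : Type*) [CommRing κ] (K : Type*) (n : ℕ) :
    TupleChain κ (n + 1) K →ₗ[κ] TupleChain κ n K :=
  Finsupp.linearCombination κ fun v =>
    ∑ i : Fin (n + 1), Finsupp.single (v ∘ i.succAbove) ((-1 : κ) ^ (i : ℕ))

/-- Put the point `b` in front of every tuple. -/
def cone (b : K) (n : ℕ) : TupleChain κ n K →ₗ[κ] TupleChain κ (n + 1) K :=
  Finsupp.lmapDomain κ κ fun v => (Fin.cons b v : Fin (n + 1) → K)

/-- The map on tuples induced by a map of sets. -/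
def map (κ : Type*) [CommRing κ] (φ : K → K') (n : ℕ) : TupleChain κ n K →ₗ[κ] TupleChain κ n K' :=
  Finsupp.lmapDomain κ κ fun v => φ ∘ v

theorem boundary_single {n : ℕ} (v : Fin (n + 1) → K) (a : κ) :
    boundary κ K n (Finsupp.single v a) =
      ∑ i : Fin (n + 1), Finsupp.single (v ∘ i.succAbove) ((-1 : κ) ^ (i : ℕ) * a) := by
  rw [boundary, Finsupp.linearCombination_single, Finset.smul_sum]
  simp only [Finsupp.smul_single, smul_eq_mul, mul_comm]

theorem cone_single {n : ℕ} (b : K) (v : Fin n → K) (a : κ) :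
    cone b n (Finsupp.single v a) = Finsupp.single (Fin.cons b v : Fin (n + 1) → K) a := by
  simp [cone]

theorem map_single {n : ℕ} (φ : K → K') (v : Fin n → K) (a : κ) :
    map κ φ n (Finsupp.single v a) = Finsupp.single (φ ∘ v) a := by
  simp [map]

/-- Tuples are indexed by length, so the empty tuple sits in degree 0 and the complex is augmented.
Coning is then a contraction with no correction term in the lowest degree. -/
theorem boundary_cone_zero (b : K) (c : TupleChain κ 0 K) : boundary κ K 0 (cone b 0 c) = c := by
  induction c using Finsupp.induction_linear with
  | zero => simp
  | add f g hf hg => simp [hf, hg]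
  | single v a =>
    rw [cone_single, boundary_single]
    refine (Fin.sum_univ_one _).trans ?_
    rw [Subsingleton.elim (_ ∘ _) v]
    simp

/-- Omitting the apex returns the base; omitting any other vertex gives the cone on a face, with the
sign shifted by one. -/
theorem boundary_cone_succ {n : ℕ} (b : K) (c : TupleChain κ (n + 1) K) :
    boundary κ K (n + 1) (cone b (n + 1) c) = c - cone b n (boundary κ K n c) := by
  induction c using Finsupp.induction_linear with
  | zero => simp
  | add f g hf hg => simp only [map_add, hf, hg]; abel
  | single v a =>
    rw [cone_single, boundary_single, boundary_single, Fin.sum_univ_succ, map_sum]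
    rw [sub_eq_add_neg, ← Finset.sum_neg_distrib]
    congr 1
    · congr 1
      simp
    · refine Finset.sum_congr rfl fun i _ => ?_
      rw [cone_single, ← Finsupp.single_neg]
      congr 1
      · funext j
        refine Fin.cases ?_ (fun j => ?_) j <;> simp
      · simp [pow_succ]

/-- Every nonempty tuple is the cone on its tail, so the contraction formula gives an induction on
length and no double sum is needed. -/
theorem boundary_boundary (n : ℕ) (c : TupleChain κ (n + 2) K) :
    boundary κ K n (boundary κ K (n + 1) c) = 0 := by
  have key : ∀ (n : ℕ) (v : Fin (n + 2) → K) (a : κ),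
      boundary κ K n (boundary κ K (n + 1) (Finsupp.single v a)) = 0 := by
    intro n
    induction n with
    | zero =>
      intro v a
      rw [← Fin.cons_self_tail v, ← cone_single, boundary_cone_succ, map_sub, boundary_cone_zero,
        sub_self]
    | succ n ih =>
      intro v a
      rw [← Fin.cons_self_tail v, ← cone_single, boundary_cone_succ, map_sub, boundary_cone_succ,
        ih]
      simp
  induction c using Finsupp.induction_linear with
  | zero => simp
  | add f g hf hg => simp [hf, hg]
  | single v a => exact key n v a

theorem boundary_map {n : ℕ} (φ : K → K') (c : TupleChain κ (n + 1) K) :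
    boundary κ K' n (map κ φ (n + 1) c) = map κ φ n (boundary κ K n c) := by
  induction c using Finsupp.induction_linear with
  | zero => simp
  | add f g hf hg => simp [hf, hg]
  | single v a =>
    simp only [map_single, boundary_single, map_sum]
    rfl

theorem map_cone {n : ℕ} (φ : K → K') (b : K) (c : TupleChain κ n K) :
    map κ φ (n + 1) (cone b n c) = cone (φ b) n (map κ φ n c) := by
  induction c using Finsupp.induction_linear with
  | zero => simp
  | add f g hf hg => simp [hf, hg]
  | single v a =>
    simp only [map_single, cone_single]
    congr 1
    funext j
    refine Fin.cases ?_ (fun j => ?_) j <;> simp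

theorem map_map {K'' : Type*} {n : ℕ} (φ : K → K') (ψ : K' → K'') (c : TupleChain κ n K) :
    map κ ψ n (map κ φ n c) = map κ (ψ ∘ φ) n c := by
  induction c using Finsupp.induction_linear with
  | zero => simp
  | add f g hf hg => simp [hf, hg]
  | single v a => simp only [map_single]; rfl

/-! ### Subdivision and homotopies by coning -/

/-- Subdivision: the cone over the subdivided boundary, with apex `b v`. For `b` the barycenter
this is barycentric subdivision. -/
def subdivision (κ : Type*) [CommRing κ] (b : ∀ n, (Fin (n + 1) → K) → K) :
    ∀ n, TupleChain κ n K →ₗ[κ] TupleChain κ n K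
  | 0 => LinearMap.id
  | n + 1 => Finsupp.linearCombination κ fun v =>
      cone (b n v) n (subdivision κ b n (boundary κ K n (Finsupp.single v 1)))

theorem single_eq_smul {n : ℕ} (v : Fin n → K) (a : κ) :
    (Finsupp.single v a : TupleChain κ n K) = a • Finsupp.single v 1 := by
  simp

theorem subdivision_single {n : ℕ} (b : ∀ n, (Fin (n + 1) → K) → K) (v : Fin (n + 1) → K) (a : κ) :
    subdivision κ b (n + 1) (Finsupp.single v a) =
      cone (b n v) n (subdivision κ b n (boundary κ K n (Finsupp.single v a))) := by
  rw [single_eq_smul v a, map_smul, map_smul, map_smul, map_smul]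
  simp [subdivision]

theorem boundary_subdivision (b : ∀ n, (Fin (n + 1) → K) → K) (n : ℕ)
    (c : TupleChain κ (n + 1) K) :
    boundary κ K n (subdivision κ b (n + 1) c) = subdivision κ b n (boundary κ K n c) := by
  induction n with
  | zero =>
    induction c using Finsupp.induction_linear with
    | zero => simp
    | add f g hf hg => simp only [map_add, hf, hg]
    | single v a => rw [subdivision_single, boundary_cone_zero]
  | succ n ih =>
    induction c using Finsupp.induction_linear with
    | zero => simp
    | add f g hf hg => simp only [map_add, hf, hg]
    | single v a =>
      rw [subdivision_single, boundary_cone_succ, ih, boundary_boundary, map_zero, map_zero,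
        sub_zero]

theorem map_subdivision (b : ∀ n, (Fin (n + 1) → K) → K) (b' : ∀ n, (Fin (n + 1) → K') → K')
    (φ : K → K') (h : ∀ n v, φ (b n v) = b' n (φ ∘ v)) (n : ℕ) (c : TupleChain κ n K) :
    map κ φ n (subdivision κ b n c) = subdivision κ b' n (map κ φ n c) := by
  induction n with
  | zero => rfl
  | succ n ih =>
    induction c using Finsupp.induction_linear with
    | zero => simp
    | add f g hf hg => simp only [map_add, hf, hg]
    | single v a =>
      rw [subdivision_single, map_cone, ih, ← boundary_map, map_single, subdivision_single, h]

/-- The homotopy between two chain maps with values in a cone, built by coning off at `b v`. -/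
def coneHomotopy (α β : ∀ n, TupleChain κ n K →ₗ[κ] TupleChain κ n K')
    (b : ∀ n, (Fin (n + 1) → K) → K') : ∀ n, TupleChain κ n K →ₗ[κ] TupleChain κ (n + 1) K'
  | 0 => 0
  | n + 1 => Finsupp.linearCombination κ fun v =>
      cone (b n v) (n + 1) (β (n + 1) (Finsupp.single v 1) - α (n + 1) (Finsupp.single v 1) -
        coneHomotopy α β b n (boundary κ K n (Finsupp.single v 1)))

theorem coneHomotopy_single {n : ℕ} (α β : ∀ n, TupleChain κ n K →ₗ[κ] TupleChain κ n K')
    (b : ∀ n, (Fin (n + 1) → K) → K') (v : Fin (n + 1) → K) (a : κ) :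
    coneHomotopy α β b (n + 1) (Finsupp.single v a) =
      cone (b n v) (n + 1) (β (n + 1) (Finsupp.single v a) - α (n + 1) (Finsupp.single v a) -
        coneHomotopy α β b n (boundary κ K n (Finsupp.single v a))) := by
  rw [single_eq_smul v a]
  simp only [map_smul, ← smul_sub]
  simp [coneHomotopy]

/-- By induction, `β v - α v` minus the homotopy on the boundary of `v` is a cycle, so coning it off
at `b v` solves the homotopy equation. The homotopy vanishes on the empty tuple, which is why `α`
and `β` must agree there. -/
theorem boundary_coneHomotopy (α β : ∀ n, TupleChain κ n K →ₗ[κ] TupleChain κ n K')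
    (b : ∀ n, (Fin (n + 1) → K) → K')
    (hα : ∀ n c, boundary κ K' n (α (n + 1) c) = α n (boundary κ K n c))
    (hβ : ∀ n c, boundary κ K' n (β (n + 1) c) = β n (boundary κ K n c))
    (h0 : α 0 = β 0) (n : ℕ) (c : TupleChain κ (n + 1) K) :
    boundary κ K' (n + 1) (coneHomotopy α β b (n + 1) c) =
      β (n + 1) c - α (n + 1) c - coneHomotopy α β b n (boundary κ K n c) := by
  induction n with
  | zero =>
    induction c using Finsupp.induction_linear with
    | zero => simp
    | add f g hf hg => simp only [map_add, hf, hg]; abel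
    | single v a =>
      rw [coneHomotopy_single, boundary_cone_succ]
      simp [hα, hβ, h0, coneHomotopy]
  | succ n ih =>
    induction c using Finsupp.induction_linear with
    | zero => simp
    | add f g hf hg => simp only [map_add, hf, hg]; abel
    | single v a =>
      rw [coneHomotopy_single, boundary_cone_succ, map_sub, map_sub, ih, boundary_boundary, map_sub, hα, hβ]
      simp

/-- The recursion uses only `α`, `β` and the apexes, so the homotopy is natural whenever these are.
This is what makes prism homotopies match along faces. -/
theorem map_coneHomotopy {L L' : Type*} (α β : ∀ n, TupleChain κ n K →ₗ[κ] TupleChain κ n K')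
    (b : ∀ n, (Fin (n + 1) → K) → K') (α' β' : ∀ n, TupleChain κ n L →ₗ[κ] TupleChain κ n L')
    (b' : ∀ n, (Fin (n + 1) → L) → L') (φ : K → L) (ψ : K' → L')
    (hα : ∀ n c, map κ ψ n (α n c) = α' n (map κ φ n c))
    (hβ : ∀ n c, map κ ψ n (β n c) = β' n (map κ φ n c))
    (hb : ∀ n v, ψ (b n v) = b' n (φ ∘ v)) (n : ℕ) (c : TupleChain κ n K) :
    map κ ψ (n + 1) (coneHomotopy α β b n c) = coneHomotopy α' β' b' n (map κ φ n c) := by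
  induction n with
  | zero => simp [coneHomotopy]
  | succ n ih =>
    induction c using Finsupp.induction_linear with
    | zero => simp
    | add f g hf hg => simp only [map_add, hf, hg]
    | single v a =>
      rw [coneHomotopy_single, map_cone, map_sub, map_sub, ih, ← boundary_map, map_single,
        coneHomotopy_single, hb, map_sub (map κ ψ (n + 1)), hα, hβ, map_single, map_sub, map_sub, map_sub]

end TupleChain

theorem Finsupp.map_mem_of_mem_supported {κ α M : Type*} [CommRing κ] [AddCommGroup M] [Module κ M]
    {S : Set α} (f : (α →₀ κ) →ₗ[κ] M) (N : Submodule κ M)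
    (h : ∀ v ∈ S, f (Finsupp.single v 1) ∈ N) {c : α →₀ κ} (hc : c ∈ Finsupp.supported κ κ S) :
    f c ∈ N := by
  rw [Finsupp.supported_eq_span_single] at hc
  refine (Submodule.span_le (p := N.comap f)).2 ?_ hc
  rintro _ ⟨v, hv, rfl⟩
  exact h v hv

/-! ### Singular chains -/

/-- The standard topological simplex. -/
abbrev TopSimplex (n : ℕ) := stdSimplex ℝ (Fin (n + 1))

/-- Singular chains: formal linear combinations of singular simplices. -/
abbrev SingularChain (κ : Type*) [CommRing κ] (n : ℕ) (Y : Type*) [TopologicalSpace Y] :=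
  C(TopSimplex n, Y) →₀ κ

/-- The inclusion of a face of the standard simplex. -/
def TopSimplex.face {n : ℕ} (i : Fin (n + 2)) : C(TopSimplex n, TopSimplex (n + 1)) :=
  ⟨stdSimplex.map i.succAbove, stdSimplex.continuous_map _⟩

/-- The vertices of the standard simplex. -/
abbrev TopSimplex.vertex {n : ℕ} (i : Fin (n + 1)) : TopSimplex n := stdSimplex.vertex i

theorem stdSimplex.sum_map_smul {ι ι' V : Type*} [Fintype ι] [Fintype ι'] [AddCommGroup V]
    [Module ℝ V] (f : ι → ι') (s : stdSimplex ℝ ι) (w : ι' → V) :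
    ∑ k, (stdSimplex.map f s) k • w k = ∑ j, s j • w (f j) := by
  classical
  rw [stdSimplex.map_coe]
  simp only [FunOnFinite.linearMap_apply_apply, Finset.sum_smul]
  rw [← Finset.sum_fiberwise (s := Finset.univ) (g := f)]
  refine Finset.sum_congr rfl fun k _ => Finset.sum_congr (by ext; simp) fun j hj => ?_
  simp only [Finset.mem_filter] at hj
  rw [hj.2]

theorem TopSimplex.sum_smul_vertex {n : ℕ} (s : TopSimplex n) :
    ∑ j, s j • ((TopSimplex.vertex j : TopSimplex n) : Fin (n + 1) → ℝ) = s := by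
  funext k
  simp [Finset.sum_apply, Pi.single_apply]

namespace SingularChain

variable {κ : Type*} [CommRing κ] {Y Z : Type*} [TopologicalSpace Y] [TopologicalSpace Z]

/-- The singular boundary operator. -/
def boundary (κ : Type*) [CommRing κ] (Y : Type*) [TopologicalSpace Y] (n : ℕ) :
    SingularChain κ (n + 1) Y →ₗ[κ] SingularChain κ n Y :=
  Finsupp.linearCombination κ fun σ =>
    ∑ i : Fin (n + 2), Finsupp.single (σ.comp (TopSimplex.face i)) ((-1 : κ) ^ (i : ℕ))

theorem boundary_single {n : ℕ} (σ : C(TopSimplex (n + 1), Y)) (a : κ) :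
    boundary κ Y n (Finsupp.single σ a) =
      ∑ i : Fin (n + 2), Finsupp.single (σ.comp (TopSimplex.face i)) ((-1 : κ) ^ (i : ℕ) * a) := by
  rw [boundary, Finsupp.linearCombination_single, Finset.smul_sum]
  simp only [Finsupp.smul_single, smul_eq_mul, mul_comm]

/-- The map on singular chains induced by a continuous map. -/
def map (κ : Type*) [CommRing κ] (φ : C(Y, Z)) (n : ℕ) :
    SingularChain κ n Y →ₗ[κ] SingularChain κ n Z :=
  Finsupp.lmapDomain κ κ fun σ => φ.comp σ

theorem map_single {n : ℕ} (φ : C(Y, Z)) (σ : C(TopSimplex n, Y)) (a : κ) :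
    map κ φ n (Finsupp.single σ a) = Finsupp.single (φ.comp σ) a := by
  simp [map]

theorem boundary_map {n : ℕ} (φ : C(Y, Z)) (c : SingularChain κ (n + 1) Y) :
    boundary κ Z n (map κ φ (n + 1) c) = map κ φ n (boundary κ Y n c) := by
  induction c using Finsupp.induction_linear with
  | zero => simp
  | add f g hf hg => simp [hf, hg]
  | single v a =>
    simp only [map_single, boundary_single, map_sum]
    rfl

/-- A singular chain is a cycle if its boundary vanishes; there is no condition in degree `0`. -/
def IsCycle : ∀ {n : ℕ}, SingularChain κ n Y → Prop
  | 0, _ => True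
  | n + 1, z => boundary κ Y n z = 0

end SingularChain

/-! ### Affine simplices in convex sets -/

section Affine

variable {V W : Type*} [NormedAddCommGroup V] [NormedSpace ℝ V] [NormedAddCommGroup W]
  [NormedSpace ℝ W] {D : Set V} {D' : Set W}

/-- The affine simplex with the given vertices in a convex set. -/
def affineSimplex (hD : Convex ℝ D) {n : ℕ} (w : Fin (n + 1) → D) : C(TopSimplex n, D) where
  toFun s := ⟨∑ j, s j • (w j : V),
    hD.sum_mem (fun j _ => s.2.1 j) s.2.2 fun j _ => (w j).2⟩
  continuous_toFun := by
    refine Continuous.subtype_mk (continuous_finsetSum _ fun j _ => ?_) _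
    exact ((continuous_apply j).comp continuous_subtype_val).smul continuous_const

theorem affineSimplex_coe (hD : Convex ℝ D) {n : ℕ} (w : Fin (n + 1) → D) (s : TopSimplex n) :
    (affineSimplex hD w s : V) = ∑ j, s j • (w j : V) := rfl

theorem affineSimplex_comp_face (hD : Convex ℝ D) {n : ℕ} (w : Fin (n + 2) → D) (i : Fin (n + 2)) :
    (affineSimplex hD w).comp (TopSimplex.face i) = affineSimplex hD (w ∘ i.succAbove) := by
  ext s
  exact stdSimplex.sum_map_smul i.succAbove s fun k => (w k : V)

theorem map_affineSimplex (hD : Convex ℝ D) (hD' : Convex ℝ D') (φ : D → D') (A : V →ₗ[ℝ] W)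
    (hφ : ∀ x, (φ x : W) = A x) {n : ℕ} (w : Fin (n + 1) → D) (s : TopSimplex n) :
    φ (affineSimplex hD w s) = affineSimplex hD' (φ ∘ w) s := by
  apply Subtype.ext
  simp [hφ, affineSimplex_coe]

variable {κ : Type*} [CommRing κ] {Y Z : Type*} [TopologicalSpace Y] [TopologicalSpace Z]

/-- The singular chain `σ ∘ c` for a continuous map `σ` on a convex set and a chain `c` of tuples,
regarded as affine simplices. -/
def realize (κ : Type*) [CommRing κ] (hD : Convex ℝ D) (σ : C(D, Y)) (n : ℕ) :
    TupleChain κ (n + 1) D →ₗ[κ] SingularChain κ n Y :=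
  Finsupp.lmapDomain κ κ fun w => σ.comp (affineSimplex hD w)

theorem realize_single (hD : Convex ℝ D) (σ : C(D, Y)) {n : ℕ} (w : Fin (n + 1) → D) (a : κ) :
    realize κ hD σ n (Finsupp.single w a) = Finsupp.single (σ.comp (affineSimplex hD w)) a := by
  simp [realize]

theorem boundary_realize (hD : Convex ℝ D) (σ : C(D, Y)) {n : ℕ} (c : TupleChain κ (n + 2) D) :
    SingularChain.boundary κ Y n (realize κ hD σ (n + 1) c) =
      realize κ hD σ n (TupleChain.boundary κ D (n + 1) c) := by
  induction c using Finsupp.induction_linear with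
  | zero => simp
  | add f g hf hg => simp [hf, hg]
  | single v a =>
    simp only [realize_single, SingularChain.boundary_single, TupleChain.boundary_single, map_sum,
      ContinuousMap.comp_assoc, affineSimplex_comp_face]

theorem realize_map (hD : Convex ℝ D) (hD' : Convex ℝ D') (φ : C(D, D')) (A : V →ₗ[ℝ] W)
    (hφ : ∀ x, (φ x : W) = A x) (σ : C(D', Y)) {n : ℕ} (c : TupleChain κ (n + 1) D) :
    realize κ hD' σ n (TupleChain.map κ φ (n + 1) c) = realize κ hD (σ.comp φ) n c := by
  induction c using Finsupp.induction_linear with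
  | zero => simp
  | add f g hf hg => simp [hf, hg]
  | single v a =>
    rw [TupleChain.map_single, realize_single, realize_single]
    congr 1
    ext s
    simp [map_affineSimplex hD hD' φ A hφ]

/-! ### Barycentric subdivision and its mesh -/

/-- The barycenter of a tuple of points in a convex set. -/
def tupleBarycenter (hD : Convex ℝ D) (n : ℕ) (w : Fin (n + 1) → D) : D :=
  affineSimplex hD w stdSimplex.barycenter

/-- Iterated barycentric subdivision of tuples. -/
def barySubdivision (κ : Type*) [CommRing κ] (hD : Convex ℝ D) (k n : ℕ) :
    TupleChain κ n D →ₗ[κ] TupleChain κ n D :=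
  TupleChain.subdivision κ (tupleBarycenter hD) n ^ k

theorem barySubdivision_zero (hD : Convex ℝ D) (n : ℕ) (c : TupleChain κ n D) :
    barySubdivision κ hD 0 n c = c := rfl

theorem barySubdivision_succ (hD : Convex ℝ D) (k n : ℕ) (c : TupleChain κ n D) :
    barySubdivision κ hD (k + 1) n c =
      TupleChain.subdivision κ (tupleBarycenter hD) n (barySubdivision κ hD k n c) := by
  rw [barySubdivision, pow_succ']
  rfl

theorem boundary_barySubdivision (hD : Convex ℝ D) (k n : ℕ) (c : TupleChain κ (n + 1) D) :
    TupleChain.boundary κ D n (barySubdivision κ hD k (n + 1) c) =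
      barySubdivision κ hD k n (TupleChain.boundary κ D n c) := by
  induction k with
  | zero => rfl
  | succ k ih =>
    rw [barySubdivision_succ, barySubdivision_succ, TupleChain.boundary_subdivision, ih]

theorem map_barySubdivision (hD : Convex ℝ D) (hD' : Convex ℝ D') (φ : D → D') (A : V →ₗ[ℝ] W)
    (hφ : ∀ x, (φ x : W) = A x) (k n : ℕ) (c : TupleChain κ n D) :
    TupleChain.map κ φ n (barySubdivision κ hD k n c) =
      barySubdivision κ hD' k n (TupleChain.map κ φ n c) := by
  induction k with
  | zero => rfl
  | succ k ih =>
    rw [barySubdivision_succ, barySubdivision_succ, TupleChain.map_subdivision (b' :=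
      tupleBarycenter hD'), ih]
    intro n v
    exact map_affineSimplex hD hD' φ A hφ v _

theorem barySubdivision_tuple_zero (hD : Convex ℝ D) (k : ℕ) :
    barySubdivision κ hD k 0 = LinearMap.id := by
  rw [barySubdivision, TupleChain.subdivision]
  exact one_pow k

/-- The difference is the average of the `n + 1` vectors `v j - v i`, one of which is zero. The
uniform `N` allows one contraction factor through an induction on dimension. -/
theorem dist_tupleBarycenter_le (hD : Convex ℝ D) {n N : ℕ} (hn : n + 1 ≤ N) (v : Fin (n + 1) → D)
    {δ : ℝ} (hδ : ∀ i j, dist (v i) (v j) ≤ δ) (i : Fin (n + 1)) :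
    dist (tupleBarycenter hD n v) (v i) ≤ (1 - (N : ℝ)⁻¹) * δ := by
  have hδ0 : 0 ≤ δ := (dist_self (v i)) ▸ hδ i i
  have h1 : (tupleBarycenter hD n v : V) - v i = ∑ j, ((n : ℝ) + 1)⁻¹ • ((v j : V) - v i) := by
    rw [tupleBarycenter, affineSimplex_coe, ← Finset.smul_sum, Finset.sum_sub_distrib, smul_sub,
      Finset.smul_sum]
    congr 1
    · refine Finset.sum_congr rfl fun j _ => ?_
      congr 1
      exact (stdSimplex.barycenter_apply j).trans (by simp)
    · rw [Finset.sum_const, Finset.card_univ, Fintype.card_fin, ← Nat.cast_smul_eq_nsmul ℝ, smul_smul]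
      push_cast
      rw [inv_mul_cancel₀ (by positivity), one_smul]
  rw [Subtype.dist_eq, dist_eq_norm, h1]
  calc ‖∑ j, ((n : ℝ) + 1)⁻¹ • ((v j : V) - v i)‖
      ≤ ∑ j, ‖((n : ℝ) + 1)⁻¹ • ((v j : V) - v i)‖ := norm_sum_le _ _
    _ ≤ ∑ j, if j = i then 0 else ((n : ℝ) + 1)⁻¹ * δ := by
        refine Finset.sum_le_sum fun j _ => ?_
        split_ifs with h
        · simp [h]
        · rw [norm_smul, Real.norm_of_nonneg (by positivity), ← dist_eq_norm, ← Subtype.dist_eq]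
          exact mul_le_mul_of_nonneg_left (hδ j i) (by positivity)
    _ = (1 - ((n : ℝ) + 1)⁻¹) * δ := by
        rw [Finset.sum_ite]
        simp only [Finset.sum_const_zero, zero_add, Finset.sum_const, nsmul_eq_mul,
          Finset.filter_ne', Finset.card_erase_of_mem (Finset.mem_univ _), Finset.card_univ,
          Fintype.card_fin, Nat.add_sub_cancel]
        field_simp
        ring
    _ ≤ (1 - (N : ℝ)⁻¹) * δ := by
        gcongr
        exact_mod_cast hn

/-- The tuples with mutual distances at most `δ`. -/
def smallTuples (D : Set V) (n : ℕ) (δ : ℝ) : Set (Fin n → D) := {w | ∀ i j, dist (w i) (w j) ≤ δ}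

theorem subdivision_single_mem_supported (hD : Convex ℝ D) {n N : ℕ} (hn : n ≤ N) (v : Fin n → D)
    {δ : ℝ} (hδ : ∀ i j, dist (v i) (v j) ≤ δ) :
    TupleChain.subdivision κ (tupleBarycenter hD) n (Finsupp.single v 1) ∈
      Finsupp.supported κ κ {w | (∀ i, (w i : V) ∈ convexHull ℝ (Set.range fun i => (v i : V))) ∧
        w ∈ smallTuples D n ((1 - (N : ℝ)⁻¹) * δ)} := by
  induction n with
  | zero =>
    refine (Finsupp.mem_supported _ _).2 fun w _ => ⟨fun i => i.elim0, fun i => i.elim0⟩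
  | succ n ih =>
    have hδ0 : 0 ≤ δ := (dist_self (v 0)) ▸ hδ 0 0
    have hN : 0 ≤ 1 - (N : ℝ)⁻¹ := by
      rw [sub_nonneg]
      exact inv_le_one_of_one_le₀ (by exact_mod_cast (Nat.succ_le_succ (Nat.zero_le n)).trans hn)
    rw [TupleChain.subdivision_single]
    refine Finsupp.map_mem_of_mem_supported (S := {w | (∀ i, (w i : V) ∈
      convexHull ℝ (Set.range fun i => (v i : V))) ∧ w ∈ smallTuples D n ((1 - (N : ℝ)⁻¹) * δ)})
      _ _ ?_ ?_
    · rintro w ⟨hw, hw'⟩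
      rw [TupleChain.cone_single]
      refine Finsupp.single_mem_supported _ _ ?_
      have hb : ∀ j, dist (tupleBarycenter hD n v) (w j) ≤ (1 - (N : ℝ)⁻¹) * δ := by
        intro j
        -- Distance to the barycenter is convex, hence largest over the hull at a vertex; the hull
        -- clause of the induction exists for this.
        obtain ⟨x, ⟨i, rfl⟩, hx⟩ := convexHull_exists_dist_ge (hw j) (tupleBarycenter hD n v : V)
        rw [dist_comm, Subtype.dist_eq]
        refine hx.trans ?_
        rw [dist_comm]
        exact dist_tupleBarycenter_le hD hn v hδ i
      constructor
      · refine Fin.cases ?_ fun i => ?_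
        · simp only [Fin.cons_zero]
          rw [tupleBarycenter, affineSimplex_coe]
          exact (convex_convexHull ℝ _).sum_mem (fun j _ => stdSimplex.barycenter.2.1 j)
            stdSimplex.barycenter.2.2 fun j _ => subset_convexHull ℝ _ ⟨j, rfl⟩
        · simpa using hw i
      · refine Fin.cases ?_ fun i => ?_
        · refine Fin.cases ?_ fun j => ?_
          · simpa using mul_nonneg hN hδ0
          · simpa using hb j
        · refine Fin.cases ?_ fun j => ?_
          · simpa [dist_comm] using hb i
          · simpa using hw' i j
    · rw [TupleChain.boundary_single, map_sum]
      refine Submodule.sum_mem _ fun i _ => ?_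
      rw [TupleChain.single_eq_smul, map_smul]
      refine Submodule.smul_mem _ _ (Finsupp.supported_mono ?_ (ih (by omega) (v ∘ i.succAbove)
        fun j k => hδ _ _))
      rintro w ⟨hw, hw'⟩
      refine ⟨fun j => convexHull_mono ?_ (hw j), hw'⟩
      rintro _ ⟨k, rfl⟩
      exact ⟨_, rfl⟩

theorem barySubdivision_mem_supported (hD : Convex ℝ D) {n : ℕ} {δ : ℝ} {c : TupleChain κ n D}
    (hc : c ∈ Finsupp.supported κ κ (smallTuples D n δ)) (k : ℕ) :
    barySubdivision κ hD k n c ∈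
      Finsupp.supported κ κ (smallTuples D n ((1 - (n : ℝ)⁻¹) ^ k * δ)) := by
  induction k with
  | zero => simpa [barySubdivision_zero] using hc
  | succ k ih =>
    rw [barySubdivision_succ]
    refine Finsupp.map_mem_of_mem_supported _ _ (fun v hv => ?_) ih
    refine Finsupp.supported_mono ?_ (subdivision_single_mem_supported hD le_rfl v hv)
    rintro w ⟨-, hw⟩
    rwa [pow_succ', mul_assoc]

theorem dist_affineSimplex_le (hD : Convex ℝ D) {n : ℕ} {w : Fin (n + 1) → D} {δ : ℝ}
    (hw : w ∈ smallTuples D (n + 1) δ) (s s' : TopSimplex n) :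
    dist (affineSimplex hD w s) (affineSimplex hD w s') ≤ δ := by
  have h : ∀ s, (affineSimplex hD w s : V) ∈ convexHull ℝ (Set.range fun i => (w i : V)) :=
    fun s => (convex_convexHull ℝ _).sum_mem (fun j _ => s.2.1 j) s.2.2
      fun j _ => subset_convexHull ℝ _ ⟨j, rfl⟩
  obtain ⟨_, ⟨i, rfl⟩, _, ⟨j, rfl⟩, hij⟩ := convexHull_exists_dist_ge2 (h s) (h s')
  exact hij.trans (hw i j)

end Affine

/-! ### Prisms -/

/-- The prism `[0, 1] × Δⁿ`. -/
def prism (n : ℕ) : Set (ℝ × (Fin (n + 1) → ℝ)) :=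
  Set.Icc 0 1 ×ˢ stdSimplex ℝ (Fin (n + 1))

theorem convex_prism (n : ℕ) : Convex ℝ (prism n) :=
  (convex_Icc 0 1).prod (convex_stdSimplex ℝ _)

instance (n : ℕ) : CompactSpace (prism n) :=
  isCompact_iff_compactSpace.1 (isCompact_Icc.prod (isCompact_stdSimplex ℝ _))

namespace Prism

/-- The map `s ↦ (t, s)` to the prism. -/
def slice {n : ℕ} (t : unitInterval) : C(TopSimplex n, prism n) where
  toFun s := ⟨(t, s), t.2, s.2⟩
  continuous_toFun := by fun_prop

/-- The projection of the prism to the simplex. -/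
def proj (n : ℕ) : C(prism n, TopSimplex n) where
  toFun x := ⟨x.1.2, x.2.2⟩
  continuous_toFun := by fun_prop

/-- The identification of the prism with a product. -/
def toProd (n : ℕ) : C(prism n, unitInterval × TopSimplex n) where
  toFun x := (⟨x.1.1, x.2.1⟩, ⟨x.1.2, x.2.2⟩)
  continuous_toFun := by fun_prop

/-- The inclusion of a face of the prism. -/
def face {n : ℕ} (i : Fin (n + 2)) : C(prism n, prism (n + 1)) where
  toFun x := ⟨(x.1.1, TopSimplex.face i (proj n x)), x.2.1, (TopSimplex.face i (proj n x)).2⟩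
  continuous_toFun := by fun_prop

theorem face_coe {n : ℕ} (i : Fin (n + 2)) (x : prism n) :
    (face i x : ℝ × (Fin (n + 2) → ℝ)) =
      (LinearMap.id.prodMap (FunOnFinite.linearMap ℝ ℝ i.succAbove) :
        ℝ × (Fin (n + 1) → ℝ) →ₗ[ℝ] ℝ × (Fin (n + 2) → ℝ)) x := by
  rfl

theorem proj_comp_slice (n : ℕ) (t : unitInterval) :
    (proj n).comp (slice t) = ContinuousMap.id _ := rfl

theorem face_slice_vertex {n : ℕ} (i : Fin (n + 2)) (t : unitInterval) (j : Fin (n + 1)) :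
    face i (slice t (TopSimplex.vertex j)) = slice t (TopSimplex.vertex (i.succAbove j)) := by
  apply Subtype.ext
  refine Prod.ext rfl ?_
  exact congrArg Subtype.val (stdSimplex.map_vertex (S := ℝ) i.succAbove j)

theorem affineSimplex_slice_vertex (n : ℕ) (t : unitInterval) :
    affineSimplex (convex_prism n) (fun i => slice t (TopSimplex.vertex i)) = slice t := by
  ext s : 2
  rw [affineSimplex_coe]
  refine Prod.ext ?_ ?_
  · rw [Prod.fst_sum]
    change ∑ j, s j * (t : ℝ) = t
    rw [← Finset.sum_mul, stdSimplex.sum_eq_one, one_mul]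
  · rw [Prod.snd_sum]
    exact TopSimplex.sum_smul_vertex s

variable (κ : Type*) [CommRing κ]

/-- The bottom simplex of the prism, on tuples of indices of vertices. -/
def bottom (m n : ℕ) : TupleChain κ n (Fin (m + 1)) →ₗ[κ] TupleChain κ n (prism m) :=
  TupleChain.map κ (fun i => slice 0 (TopSimplex.vertex i)) n

/-- The `k`-fold subdivided top simplex of the prism. -/
def top (k m n : ℕ) : TupleChain κ n (Fin (m + 1)) →ₗ[κ] TupleChain κ n (prism m) :=
  barySubdivision κ (convex_prism m) k n ∘ₗ
    TupleChain.map κ (fun i => slice 1 (TopSimplex.vertex i)) n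

/-- The chain homotopy in the prism from the bottom to the subdivided top. -/
def homotopy (k m n : ℕ) : TupleChain κ n (Fin (m + 1)) →ₗ[κ] TupleChain κ (n + 1) (prism m) :=
  TupleChain.coneHomotopy (bottom κ m) (top κ k m)
    (fun n v => tupleBarycenter (convex_prism m) n fun i => slice 0 (TopSimplex.vertex (v i))) n

variable {κ}

theorem boundary_homotopy (k m n : ℕ) (c : TupleChain κ (n + 1) (Fin (m + 1))) :
    TupleChain.boundary κ (prism m) (n + 1) (homotopy κ k m (n + 1) c) =
      top κ k m (n + 1) c - bottom κ m (n + 1) c -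
        homotopy κ k m n (TupleChain.boundary κ _ n c) := by
  refine TupleChain.boundary_coneHomotopy _ _ _ (fun n c => TupleChain.boundary_map _ _)
    (fun n c => ?_) ?_ n c
  · rw [top, top, LinearMap.comp_apply, boundary_barySubdivision, TupleChain.boundary_map]
    rfl
  -- On the empty tuple both maps give the empty tuple, which starts the homotopy.
  · refine LinearMap.ext fun c => ?_
    change TupleChain.map κ _ 0 c = _
    rw [top, LinearMap.comp_apply, barySubdivision_tuple_zero]
    induction c using Finsupp.induction_linear with
    | zero => simp
    | add f g hf hg => simp only [map_add, hf, hg]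
    | single v a =>
      rw [TupleChain.map_single, LinearMap.id_apply, TupleChain.map_single]
      congr 1
      exact Subsingleton.elim _ _

/-- The face map of prisms is the restriction of a linear map, so it preserves vertices, barycenters
and cones. -/
theorem map_face_homotopy (k : ℕ) {m : ℕ} (i : Fin (m + 2)) (n : ℕ)
    (c : TupleChain κ n (Fin (m + 1))) :
    TupleChain.map κ (face i) (n + 1) (homotopy κ k m n c) =
      homotopy κ k (m + 1) n (TupleChain.map κ i.succAbove n c) := by
  refine TupleChain.map_coneHomotopy _ _ _ _ _ _ _ _ (fun n c => ?_) (fun n c => ?_) (fun n v => ?_)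
    n c
  · rw [bottom, bottom, TupleChain.map_map, TupleChain.map_map]
    congr 2
    funext j
    exact face_slice_vertex i 0 j
  · rw [top, top, LinearMap.comp_apply, LinearMap.comp_apply,
      map_barySubdivision (convex_prism m) (convex_prism (m + 1)) _ _ (face_coe i),
      TupleChain.map_map, TupleChain.map_map]
    congr 3
    funext j
    exact face_slice_vertex i 1 j
  · rw [tupleBarycenter,
      map_affineSimplex (convex_prism m) (convex_prism (m + 1)) _ _ (face_coe i)]
    congr 2
    funext j
    exact face_slice_vertex i 0 _

/-! ### From prisms to singular chains -/

variable {Y Y' : Type*} [TopologicalSpace Y] [TopologicalSpace Y']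

/-- The chain formed by the `k`-fold subdivided tops of a family of maps of prisms. -/
def topChain (k : ℕ) {n : ℕ} (H : C(TopSimplex n, Y) → C(prism n, Y')) :
    SingularChain κ n Y →ₗ[κ] SingularChain κ n Y' :=
  Finsupp.linearCombination κ fun σ =>
    realize κ (convex_prism n) (H σ) n (top κ k n (n + 1) (Finsupp.single id 1))

/-- The chain formed by the bottoms of a family of maps of prisms. -/
def bottomChain {n : ℕ} (H : C(TopSimplex n, Y) → C(prism n, Y')) :
    SingularChain κ n Y →ₗ[κ] SingularChain κ n Y' :=
  Finsupp.linearCombination κ fun σ => Finsupp.single ((H σ).comp (slice 0)) 1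

/-- The chain formed by the prisms themselves. -/
def prismChain (k : ℕ) {n : ℕ} (H : C(TopSimplex n, Y) → C(prism n, Y')) :
    SingularChain κ n Y →ₗ[κ] SingularChain κ (n + 1) Y' :=
  Finsupp.linearCombination κ fun σ =>
    realize κ (convex_prism n) (H σ) (n + 1) (homotopy κ k n (n + 1) (Finsupp.single id 1))

theorem realize_bottom {n : ℕ} (h : C(prism n, Y)) :
    realize κ (convex_prism n) h n (bottom κ n (n + 1) (Finsupp.single id 1)) =
      Finsupp.single (h.comp (slice 0)) 1 := by
  rw [bottom, TupleChain.map_single, realize_single]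
  congr 2
  exact affineSimplex_slice_vertex n 0

theorem boundary_realize_homotopy_zero (k : ℕ) (h : C(prism 0, Y)) :
    SingularChain.boundary κ Y 0
        (realize κ (convex_prism 0) h 1 (homotopy κ k 0 1 (Finsupp.single id 1))) =
      realize κ (convex_prism 0) h 0 (top κ k 0 1 (Finsupp.single id 1)) -
        Finsupp.single (h.comp (slice 0)) 1 := by
  rw [boundary_realize, boundary_homotopy, map_sub, map_sub, realize_bottom, homotopy,
    TupleChain.coneHomotopy]
  simp

/-- The boundary of a prism is top minus bottom minus walls; `hσ` identifies the walls with the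
prisms over the faces of `σ`. -/
theorem boundary_realize_homotopy_succ (k n : ℕ) (H : C(TopSimplex n, Y) → C(prism n, Y'))
    (h : C(prism (n + 1), Y')) (σ : C(TopSimplex (n + 1), Y))
    (hσ : ∀ i, H (σ.comp (TopSimplex.face i)) = h.comp (face i)) :
    SingularChain.boundary κ Y' (n + 1)
        (realize κ (convex_prism (n + 1)) h (n + 2)
          (homotopy κ k (n + 1) (n + 2) (Finsupp.single id 1))) =
      realize κ (convex_prism (n + 1)) h (n + 1) (top κ k (n + 1) (n + 2) (Finsupp.single id 1)) -
        Finsupp.single (h.comp (slice 0)) 1 -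
          prismChain k H (SingularChain.boundary κ Y n (Finsupp.single σ 1)) := by
  rw [boundary_realize, boundary_homotopy, map_sub, map_sub, realize_bottom]
  congr 1
  rw [TupleChain.boundary_single, SingularChain.boundary_single, map_sum, map_sum, map_sum]
  refine Finset.sum_congr rfl fun i _ => ?_
  rw [prismChain, Finsupp.linearCombination_single, hσ,
    ← realize_map (convex_prism n) (convex_prism (n + 1)) (face i) _ (face_coe i),
    map_face_homotopy, TupleChain.map_single, TupleChain.single_eq_smul, map_smul, map_smul]
  rfl

theorem linearCombination_congr {α M : Type*} [AddCommGroup M] [Module κ M] {f g : α → M}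
    {c : α →₀ κ} (h : ∀ x ∈ c.support, f x = g x) :
    Finsupp.linearCombination κ f c = Finsupp.linearCombination κ g c := by
  rw [Finsupp.linearCombination_apply, Finsupp.linearCombination_apply]
  exact Finset.sum_congr rfl fun x hx => by simp only [h x hx]

theorem exists_boundary_eq_topChain_sub_bottomChain (k : ℕ)
    (H : ∀ n, C(TopSimplex n, Y) → C(prism n, Y')) {n : ℕ} (z : SingularChain κ n Y)
    (hz : z.IsCycle)
    (hH : ∀ m, ∀ σ : C(TopSimplex (m + 1), Y), ∀ h : n = m + 1, (h ▸ σ) ∈ z.support →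
      ∀ i, H m (σ.comp (TopSimplex.face i)) = (H (m + 1) σ).comp (face i)) :
    ∃ w, SingularChain.boundary κ Y' n w = topChain k (H n) z - bottomChain (H n) z := by
  refine ⟨prismChain k (H n) z, ?_⟩
  have key : ∀ f : C(TopSimplex n, Y) → SingularChain κ (n + 1) Y',
      SingularChain.boundary κ Y' n (Finsupp.linearCombination κ f z) =
        Finsupp.linearCombination κ (fun σ => SingularChain.boundary κ Y' n (f σ)) z := by
    intro f
    rw [Finsupp.linearCombination_apply, Finsupp.linearCombination_apply, map_finsuppSum]
    simp only [map_smul]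
  have hsub : ∀ f g : C(TopSimplex n, Y) → SingularChain κ n Y',
      Finsupp.linearCombination κ (fun σ => f σ - g σ) z =
        Finsupp.linearCombination κ f z - Finsupp.linearCombination κ g z := by
    intro f g
    simp only [Finsupp.linearCombination_apply, Finsupp.sum, smul_sub, Finset.sum_sub_distrib]
  rw [prismChain, key, topChain, bottomChain, ← hsub]
  cases n with
  | zero => exact linearCombination_congr fun σ _ => boundary_realize_homotopy_zero k (H 0 σ)
  | succ n =>
    rw [linearCombination_congr fun σ hσ => boundary_realize_homotopy_succ k n (H n) (H (n + 1) σ) σ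
      fun i => hH n σ rfl hσ i, hsub, sub_eq_self]
    have h : (fun σ => prismChain k (H n) (SingularChain.boundary κ Y n (Finsupp.single σ 1))) =
        fun σ => (prismChain k (H n) ∘ₗ SingularChain.boundary κ Y n) (Finsupp.single σ 1) := rfl
    have h2 : ∀ L : SingularChain κ (n + 1) Y →ₗ[κ] SingularChain κ (n + 1) Y',
        Finsupp.linearCombination κ (fun σ => L (Finsupp.single σ 1)) z = L z := by
      intro L
      rw [Finsupp.linearCombination_apply]
      conv_rhs => rw [← Finsupp.sum_single z, map_finsuppSum]
      refine Finset.sum_congr rfl fun σ _ => ?_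
      change z σ • L _ = L _
      rw [← map_smul, Finsupp.smul_single_one]
    -- The walls add up to the prism chain of the boundary of `z`, which is zero.
    rw [h, h2, LinearMap.comp_apply, show SingularChain.boundary κ Y n z = 0 from hz, map_zero]

end Prism

open Prism

variable {κ : Type*} [CommRing κ] {Y Y' : Type*} [TopologicalSpace Y] [TopologicalSpace Y']

/-- Homotopies of singular simplices that are compatible with faces do not change the homology
class of a cycle. -/
theorem SingularChain.exists_boundary_eq_of_homotopy
    (H : ∀ n, C(TopSimplex n, Y) → C(prism n, Y)) {n : ℕ} (z : SingularChain κ n Y)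
    (hz : z.IsCycle) (h0 : ∀ σ ∈ z.support, (H n σ).comp (slice 0) = σ)
    (hH : ∀ m, ∀ σ : C(TopSimplex (m + 1), Y), ∀ h : n = m + 1, (h ▸ σ) ∈ z.support →
      ∀ i, H m (σ.comp (TopSimplex.face i)) = (H (m + 1) σ).comp (face i)) :
    ∃ w, SingularChain.boundary κ Y n w =
      Finsupp.lmapDomain κ κ (fun σ => (H n σ).comp (slice 1)) z - z := by
  -- With `k = 0` the top is left unsubdivided, so it is a single simplex.
  obtain ⟨w, hw⟩ := exists_boundary_eq_topChain_sub_bottomChain 0 H z hz hH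
  refine ⟨w, hw.trans ?_⟩
  congr 1
  · rw [topChain, Finsupp.lmapDomain_apply, Finsupp.mapDomain, Finsupp.linearCombination_apply]
    refine Finset.sum_congr rfl fun σ _ => ?_
    change z σ • realize κ _ (H n σ) n _ = Finsupp.single _ (z σ)
    rw [top, LinearMap.comp_apply, barySubdivision_zero, TupleChain.map_single, realize_single]
    simp only [Finsupp.smul_single, smul_eq_mul, mul_one]
    congr 2
    exact affineSimplex_slice_vertex n 1
  · rw [bottomChain, linearCombination_congr (g := fun σ => Finsupp.single σ 1)
      fun σ hσ => by rw [h0 σ hσ]]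
    rw [Finsupp.linearCombination_apply]
    simp

/-- Subdivision: a cycle is homologous to one all of whose simplices are obtained from the given
ones by restriction to small affine simplices. -/
theorem SingularChain.exists_boundary_eq_subdivision {n : ℕ} (z : SingularChain κ n Y)
    (hz : z.IsCycle) {δ : ℝ} (hδ : 0 < δ) :
    ∃ w z', SingularChain.boundary κ Y n w = z' - z ∧ ∀ τ ∈ z'.support, ∃ σ ∈ z.support,
      ∃ u : C(TopSimplex n, prism n), (∀ s s', dist (u s) (u s') ≤ δ) ∧
        τ = (σ.comp (proj n)).comp u := by
  obtain ⟨k, hk⟩ : ∃ k : ℕ, (1 - ((n + 1 : ℕ) : ℝ)⁻¹) ^ k < δ := by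
    refine exists_pow_lt_of_lt_one hδ ?_
    have : (0 : ℝ) < ((n + 1 : ℕ) : ℝ)⁻¹ := by positivity
    linarith
  -- Constant homotopies, so that only the subdivision of the top changes the cycle.
  obtain ⟨w, hw⟩ := exists_boundary_eq_topChain_sub_bottomChain k
    (fun n σ => σ.comp (proj n)) z hz fun m σ h hσ i => rfl
  refine ⟨w, topChain k (fun σ => σ.comp (proj n)) z, hw.trans ?_, ?_⟩
  · congr 1
    rw [bottomChain, Finsupp.linearCombination_apply]
    simp only [ContinuousMap.comp_assoc, proj_comp_slice, ContinuousMap.comp_id]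
    simp
  · suffices h : topChain k (fun σ => σ.comp (proj n)) z ∈ Finsupp.supported κ κ
        {τ | ∃ σ ∈ z.support, ∃ u : C(TopSimplex n, prism n), (∀ s s', dist (u s) (u s') ≤ δ) ∧
          τ = (σ.comp (proj n)).comp u} from fun τ hτ => (Finsupp.mem_supported _ _).1 h hτ
    rw [topChain, Finsupp.linearCombination_apply]
    refine Submodule.sum_mem _ fun σ hσ => Submodule.smul_mem _ _ ?_
    rw [top, LinearMap.comp_apply, TupleChain.map_single]
    -- The initial mesh 1 bounds the distances between top vertices: the first coordinate is
    -- constant and the standard simplex has diameter at most 1.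
    refine Finsupp.map_mem_of_mem_supported _ _ ?_ (barySubdivision_mem_supported
      (convex_prism n) (δ := 1) (Finsupp.single_mem_supported κ 1 ?_) k)
    · intro v hv
      rw [realize_single]
      refine Finsupp.single_mem_supported κ 1 ⟨σ, hσ, _, fun s s' => ?_, rfl⟩
      refine (dist_affineSimplex_le (convex_prism n) hv s s').trans ?_
      rw [mul_one]
      exact hk.le
    · intro i j
      rw [Subtype.dist_eq, Prod.dist_eq, max_le_iff]
      constructor
      · simp [slice]
      · exact (Metric.dist_le_diam_of_mem (bounded_stdSimplex _) (TopSimplex.vertex i).2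
          (TopSimplex.vertex j).2).trans diam_stdSimplex_le

/-! ### Comparison with the singular homology of Mathlib -/

section Comparison

open AlgebraicTopology Simplicial Opposite

variable (κ : Type u) [Field κ] (Y : Type u) [TopologicalSpace Y]

/-- The singular chain complex of `Y`. -/
abbrev singularComplex : ChainComplex (ModuleCat.{u} κ) ℕ :=
  (TopCat.toSSet.obj (TopCat.of Y)).chainComplex (ModuleCat.of κ κ)

variable {Y}

/-- A singular simplex as a simplex of the singular simplicial set. -/
def toSingularSet {n : ℕ} (σ : C(TopSimplex n, Y)) : (TopCat.toSSet.obj (TopCat.of Y)) _⦋n⦌ :=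
  (TopCat.toSSetObjEquiv (TopCat.of Y) (op ⦋n⦌)).symm σ

/-- The basis element of the singular chain complex given by a singular simplex. -/
def singularBasis {n : ℕ} (σ : C(TopSimplex n, Y)) : (singularComplex κ Y).X n :=
  ((TopCat.toSSet.obj (TopCat.of Y)).ιChainComplex (R := ModuleCat.of κ κ)
    (toSingularSet σ)).hom (1 : κ)

variable (Y)

/-- The comparison map from concrete singular chains. -/
def toSingularComplex (n : ℕ) : SingularChain κ n Y →ₗ[κ] (singularComplex κ Y).X n :=
  Finsupp.linearCombination κ (singularBasis κ)

theorem toSingularComplex_single {n : ℕ} (σ : C(TopSimplex n, Y)) (a : κ) :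
    toSingularComplex κ Y n (Finsupp.single σ a) = a • singularBasis κ σ := by
  simp [toSingularComplex]

/-- The inverse comparison map. -/
def ofSingularComplex (n : ℕ) :
    (singularComplex κ Y).X n ⟶ ModuleCat.of κ (SingularChain κ n Y) :=
  Limits.Sigma.desc fun x : (TopCat.toSSet.obj (TopCat.of Y)) _⦋n⦌ =>
    (ModuleCat.ofHom (Finsupp.lsingle ((TopCat.toSSetObjEquiv (TopCat.of Y) (op ⦋n⦌)) x)) :
      ModuleCat.of κ κ ⟶ ModuleCat.of κ (SingularChain κ n Y))

theorem ι_ofSingularComplex {n : ℕ} (x : (TopCat.toSSet.obj (TopCat.of Y)) _⦋n⦌) :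
    (TopCat.toSSet.obj (TopCat.of Y)).ιChainComplex (R := ModuleCat.of κ κ) x ≫
      ofSingularComplex κ Y n =
    ModuleCat.ofHom (Finsupp.lsingle ((TopCat.toSSetObjEquiv (TopCat.of Y) (op ⦋n⦌)) x)) :=
  Limits.Sigma.ι_desc _ _

theorem ofSingularComplex_singularBasis {n : ℕ} (σ : C(TopSimplex n, Y)) :
    (ofSingularComplex κ Y n).hom (singularBasis κ σ) = Finsupp.single σ 1 := by
  have h := congrArg (fun φ => φ.hom (1 : κ)) (ι_ofSingularComplex κ Y (toSingularSet σ))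
  refine Eq.trans h ?_
  change Finsupp.single _ _ = _
  congr 1

/-- The chain module is a coproduct of copies of κ indexed by the singular simplices; its universal
property supplies the inverse. -/
theorem toSingularComplex_bijective (n : ℕ) : Function.Bijective (toSingularComplex κ Y n) := by
  have h1 : ∀ c, (ofSingularComplex κ Y n).hom (toSingularComplex κ Y n c) = c := by
    intro c
    induction c using Finsupp.induction_linear with
    | zero => simp
    | add f g hf hg => rw [map_add, map_add, hf, hg]
    | single σ a =>
      rw [toSingularComplex_single, map_smul, ofSingularComplex_singularBasis]
      simp
  have h2 : ofSingularComplex κ Y n ≫ ModuleCat.ofHom (toSingularComplex κ Y n) = 𝟙 _ := by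
    refine SSet.chainComplex_hom_ext fun x => ?_
    rw [← Category.assoc, ι_ofSingularComplex, Category.comp_id]
    refine ModuleCat.hom_ext (LinearMap.ext_ring ?_)
    change toSingularComplex κ Y n (Finsupp.single _ 1) = _
    rw [toSingularComplex_single, one_smul, singularBasis, toSingularSet, Equiv.symm_apply_apply]
  refine ⟨Function.LeftInverse.injective h1, fun x => ⟨(ofSingularComplex κ Y n).hom x, ?_⟩⟩
  exact congrArg (fun φ => φ.hom x) h2

theorem d_toSingularComplex (n : ℕ) (c : SingularChain κ (n + 1) Y) :
    ((singularComplex κ Y).d (n + 1) n).hom (toSingularComplex κ Y (n + 1) c) =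
      toSingularComplex κ Y n (SingularChain.boundary κ Y n c) := by
  induction c using Finsupp.induction_linear with
  | zero => simp
  | add f g hf hg => rw [map_add, map_add, map_add, map_add, hf, hg]
  | single σ a =>
    rw [toSingularComplex_single, SingularChain.boundary_single, map_smul, map_sum]
    have h := congrArg (fun φ => φ.hom (1 : κ)) (SSet.ιChainComplex_d
      (TopCat.toSSet.obj (TopCat.of Y)) (ModuleCat.of κ κ) (toSingularSet σ))
    have h' : ((singularComplex κ Y).d (n + 1) n).hom (singularBasis κ σ) =
        ∑ i : Fin (n + 2), (-1 : ℤ) ^ (i : ℕ) • singularBasis κ (σ.comp (TopSimplex.face i)) := by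
      refine Eq.trans h ?_
      rw [ModuleCat.hom_sum, LinearMap.sum_apply]
      rfl
    rw [h', Finset.smul_sum]
    refine Finset.sum_congr rfl fun i _ => ?_
    rw [toSingularComplex_single, mul_comm, mul_smul]
    congr 1
    rcases neg_one_pow_eq_or ℤ (i : ℕ) with h | h <;>
    rcases Nat.even_or_odd (i : ℕ) with h' | h' <;> simp [h'.neg_one_pow]

variable {Y}

theorem map_toSingularComplex {Z : Type u} [TopologicalSpace Z] (φ : C(Y, Z)) (n : ℕ)
    (c : SingularChain κ n Y) :
    ((SSet.chainComplexMap (TopCat.toSSet.map (TopCat.ofHom φ)) (ModuleCat.of κ κ)).f n).hom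
      (toSingularComplex κ Y n c) = toSingularComplex κ Z n (SingularChain.map κ φ n c) := by
  induction c using Finsupp.induction_linear with
  | zero => simp
  | add f g hf hg => rw [map_add, map_add, map_add, map_add, hf, hg]
  | single σ a =>
    rw [toSingularComplex_single, SingularChain.map_single, map_smul, toSingularComplex_single]
    congr 1
    exact congrArg (fun φ => φ.hom (1 : κ)) (SSet.ι_chainComplexMap_f _ _
      (TopCat.toSSet.map (TopCat.ofHom φ)) (ModuleCat.of κ κ) (toSingularSet σ))

/-! ### Homology classes and the chains representing them -/

variable {κ}

/-- The homology class `y` is represented by the singular chain `z`. -/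
def Represents {r : ℕ} (z : SingularChain κ r Y) (y : Homology κ r Y) : Prop :=
  ∃ c : (singularComplex κ Y).cycles r,
    ((singularComplex κ Y).iCycles r).hom c = toSingularComplex κ Y r z ∧
      ((singularComplex κ Y).homologyπ r).hom c = y

namespace Represents

variable {r : ℕ}

theorem exists_chain (y : Homology κ r Y) : ∃ z : SingularChain κ r Y, Represents z y := by
  obtain ⟨c, hc⟩ := (ModuleCat.epi_iff_surjective ((singularComplex κ Y).homologyπ r)).1
    inferInstance y
  obtain ⟨z, hz⟩ := (toSingularComplex_bijective κ Y r).2 (((singularComplex κ Y).iCycles r).hom c)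
  exact ⟨z, c, hz.symm, hc⟩

theorem zero : Represents (0 : SingularChain κ r Y) 0 := ⟨0, (map_zero _).trans (map_zero _).symm, map_zero _⟩

theorem add {z z' : SingularChain κ r Y} {y y' : Homology κ r Y} (h : Represents z y)
    (h' : Represents z' y') : Represents (z + z') (y + y') := by
  obtain ⟨c, hc, rfl⟩ := h
  obtain ⟨c', hc', rfl⟩ := h'
  exact ⟨c + c', by rw [map_add, map_add, hc, hc'], map_add _ _ _⟩

theorem smul {z : SingularChain κ r Y} {y : Homology κ r Y} (a : κ) (h : Represents z y) :
    Represents (a • z) (a • y) := by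
  obtain ⟨c, hc, rfl⟩ := h
  exact ⟨a • c, by rw [map_smul, map_smul, hc], map_smul _ _ _⟩

theorem sub {z z' : SingularChain κ r Y} {y y' : Homology κ r Y} (h : Represents z y)
    (h' : Represents z' y') : Represents (z - z') (y - y') := by
  obtain ⟨c, hc, rfl⟩ := h
  obtain ⟨c', hc', rfl⟩ := h'
  exact ⟨c - c', by rw [map_sub, map_sub, hc, hc'], map_sub _ _ _⟩

theorem map {Z : Type u} [TopologicalSpace Z] (φ : C(Y, Z)) {z : SingularChain κ r Y}
    {y : Homology κ r Y} (h : Represents z y) :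
    Represents (SingularChain.map κ φ r z) (homologyMap κ r φ y) := by
  obtain ⟨c, hc, rfl⟩ := h
  let F := SSet.chainComplexMap (TopCat.toSSet.map (TopCat.ofHom φ)) (ModuleCat.of κ κ)
  refine ⟨(HomologicalComplex.cyclesMap F r).hom c, ?_, ?_⟩
  · rw [← map_toSingularComplex, ← hc]
    exact congrArg (fun f => f.hom c) (HomologicalComplex.cyclesMap_i F r)
  · exact congrArg (fun f => f.hom c) (HomologicalComplex.homologyπ_naturality F r).symm

theorem isCycle {z : SingularChain κ r Y} {y : Homology κ r Y} (h : Represents z y) :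
    z.IsCycle := by
  obtain ⟨c, hc, -⟩ := h
  cases r with
  | zero => trivial
  | succ r =>
    refine (toSingularComplex_bijective κ Y r).1 ?_
    rw [← d_toSingularComplex, ← hc, map_zero]
    exact congrArg (fun f => f.hom c) ((singularComplex κ Y).iCycles_d (r + 1) r)

/-- A chain is a map from κ, and this map lifts to the cycles once its composite with the
differential vanishes. -/
theorem of_isCycle {z : SingularChain κ r Y} (hz : z.IsCycle) : ∃ y, Represents z y := by
  let k : ModuleCat.of κ κ ⟶ (singularComplex κ Y).X r :=
    ModuleCat.ofHom (LinearMap.toSpanSingleton κ _ (toSingularComplex κ Y r z))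
  have hk : k ≫ (singularComplex κ Y).d r ((ComplexShape.down ℕ).next r) = 0 := by
    cases r with
    | zero => rw [HomologicalComplex.shape _ _ _ (by simp), Limits.comp_zero]
    | succ r =>
      rw [ChainComplex.next_nat_succ]
      refine ModuleCat.hom_ext (LinearMap.ext_ring ?_)
      change ((singularComplex κ Y).d (r + 1) r).hom
        ((1 : κ) • toSingularComplex κ Y (r + 1) z) = 0
      rw [one_smul, d_toSingularComplex, show SingularChain.boundary κ Y r z = 0 from hz, map_zero]
  refine ⟨_, ((singularComplex κ Y).liftCycles k _ rfl hk).hom (1 : κ), ?_, rfl⟩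
  refine (congrArg (fun f => f.hom (1 : κ)) ((singularComplex κ Y).liftCycles_i k _ rfl hk)).trans ?_
  exact one_smul κ _

theorem boundary (w : SingularChain κ (r + 1) Y) :
    Represents (SingularChain.boundary κ Y r w) 0 := by
  refine ⟨((singularComplex κ Y).toCycles (r + 1) r).hom (toSingularComplex κ Y (r + 1) w), ?_, ?_⟩
  · rw [← d_toSingularComplex]
    exact congrArg (fun f => f.hom (toSingularComplex κ Y (r + 1) w))
      ((singularComplex κ Y).toCycles_i (r + 1) r)
  · exact congrArg (fun f => f.hom (toSingularComplex κ Y (r + 1) w))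
      ((singularComplex κ Y).toCycles_comp_homologyπ (r + 1) r)

theorem unique {z : SingularChain κ r Y} {y y' : Homology κ r Y} (h : Represents z y)
    (h' : Represents z y') : y = y' := by
  obtain ⟨c, hc, rfl⟩ := h
  obtain ⟨c', hc', rfl⟩ := h'
  rw [(ModuleCat.mono_iff_injective ((singularComplex κ Y).iCycles r)).1 inferInstance
    (hc.trans hc'.symm)]

theorem of_boundary_eq {z z' : SingularChain κ r Y} {y : Homology κ r Y} (h : Represents z y)
    {w : SingularChain κ (r + 1) Y} (hw : SingularChain.boundary κ Y r w = z' - z) :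
    Represents z' y := by
  have := h.add (boundary w)
  rwa [hw, add_sub_cancel, add_zero] at this

end Represents

/-- The image of the homology of a subspace consists of the classes represented by chains whose
simplices lie in the subspace. -/
theorem mem_homologyImage_iff {r : ℕ} {S : Set Y} {y : Homology κ r Y} :
    y ∈ homologyImage κ r S ↔
      ∃ z : SingularChain κ r Y, Represents z y ∧ ∀ σ ∈ z.support, ∀ s, σ s ∈ S := by
  classical
  let i : C(S, Y) := ⟨Subtype.val, continuous_subtype_val⟩
  constructor
  · rintro ⟨x, rfl⟩
    obtain ⟨z, hz⟩ := Represents.exists_chain x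
    refine ⟨_, hz.map i, fun σ hσ s => ?_⟩
    obtain ⟨τ, -, rfl⟩ := Finset.mem_image.1 (Finsupp.mapDomain_support hσ)
    exact (τ s).2
  · rintro ⟨z, hz, hzS⟩
    have hi : ∀ n, Function.Injective fun σ : C(TopSimplex n, S) => i.comp σ :=
      fun n σ τ h => ContinuousMap.ext fun s => Subtype.ext (DFunLike.congr_fun h s)
    have hinj : ∀ n, Function.Injective (SingularChain.map κ i n) :=
      fun n => Finsupp.mapDomain_injective (hi n)
    obtain ⟨z', rfl⟩ : ∃ z', SingularChain.map κ i r z' = z := by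
      refine ⟨Finsupp.comapDomain (fun σ => i.comp σ) z (hi r).injOn, ?_⟩
      refine Finsupp.mapDomain_comapDomain _ (hi r) z fun σ hσ => ?_
      exact ⟨⟨fun s => ⟨σ s, hzS σ hσ s⟩, by fun_prop⟩, rfl⟩
    -- The inclusion is injective on chains, so the boundary already vanishes in `S`.
    have hz' : z'.IsCycle := by
      cases r with
      | zero => trivial
      | succ r =>
        refine hinj r ?_
        rw [← SingularChain.boundary_map, map_zero]
        exact hz.isCycle
    obtain ⟨x, hx⟩ := Represents.of_isCycle hz'
    exact ⟨x, (hx.map i).unique hz⟩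

end Comparison

/-! ### Compact absolute neighborhood retracts -/

/-- A compact ANR is a retract of a neighborhood of an isometric copy in a normed space; subordinate
to a given open cover, the retraction may be controlled on balls of a fixed radius. -/
theorem IsANR.exists_controlled_retraction {X : Type u} [MetricSpace X] [CompactSpace X] [Nonempty X]
    (hX : IsANR X) {I : Type*} (W : I → Set X) (hW : ∀ i, IsOpen (W i)) (hc : ∀ x, ∃ i, x ∈ W i) :
    ∃ (j : X → C(X, ℝ)) (ρ : C(X, ℝ) → X) (δ : ℝ), Isometry j ∧ 0 < δ ∧ (∀ x, ρ (j x) = x) ∧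
      ∀ x, ∃ i, ContinuousOn ρ (Metric.ball (j x) δ) ∧ Set.MapsTo ρ (Metric.ball (j x) δ) (W i) := by
  classical
  -- The Kuratowski embedding.
  let j : X → C(X, ℝ) := fun x => ⟨fun y => dist x y, by fun_prop⟩
  have hj : Isometry j := by
    refine Isometry.of_dist_eq fun x y => le_antisymm ?_ ?_
    · rw [ContinuousMap.dist_le dist_nonneg]
      intro z
      exact abs_dist_sub_le x y z
    · have := ContinuousMap.dist_apply_le_dist (f := j x) (g := j y) y
      simpa [j, Real.dist_eq] using this
  obtain ⟨U, hU, hUo, r, hr⟩ := hX.exists_retraction C(X, ℝ) j hj.isClosedEmbedding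
  let ρ : C(X, ℝ) → X := fun v => if h : v ∈ U then r ⟨v, h⟩ else Classical.arbitrary X
  have hρr : ∀ v : U, ρ v = r v := fun v => by simp [ρ]
  have hρ : ContinuousOn ρ U := by
    rw [continuousOn_iff_continuous_domRestrict]
    exact r.continuous.congr fun v => (hρr v).symm
  have hρj : ∀ x, ρ (j x) = x := fun x => (hρr ⟨j x, hU ⟨x, rfl⟩⟩).trans (hr x)
  -- A Lebesgue number for the compact image of `j`, covered by the open sets on which `ρ` is
  -- continuous with values in one `W i`.
  obtain ⟨δ, hδ, h⟩ := lebesgue_number_lemma_of_metric (s := Set.range j)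
    (c := fun i => U ∩ ρ ⁻¹' W i) (isCompact_range hj.continuous)
    (fun i => hρ.isOpen_inter_preimage hUo (hW i)) (by
      rintro _ ⟨x, rfl⟩
      obtain ⟨i, hi⟩ := hc x
      exact Set.mem_iUnion.2 ⟨i, hU ⟨x, rfl⟩, by simpa [hρj] using hi⟩)
  refine ⟨j, ρ, δ, hj, hδ, hρj, fun x => ?_⟩
  obtain ⟨i, hi⟩ := h (j x) ⟨x, rfl⟩
  exact ⟨i, hρ.mono fun v hv => (hi hv).1, fun v hv => (hi hv).2⟩

/-! ### Straightening of small simplices -/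

instance (n : ℕ) : PreconnectedSpace (prism n) :=
  Subtype.preconnectedSpace (convex_prism n).isPreconnected

section Straightening

variable {X V : Type*} [NormedAddCommGroup V] [NormedSpace ℝ V]

/-- The straight-line homotopy, in the normed space, from a simplex to the affine simplex whose
vertices are obtained by moving those of the given one by `q`. -/
def straightLine (j : X → V) (q : X → X) {n : ℕ} (σ : TopSimplex n → X) (x : prism n) : V :=
  (1 - x.1.1) • j (σ (Prism.proj n x)) +
    x.1.1 • ∑ i, Prism.proj n x i • j (q (σ (TopSimplex.vertex i)))

theorem straightLine_slice_zero (j : X → V) (q : X → X) {n : ℕ} (σ : TopSimplex n → X)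
    (s : TopSimplex n) : straightLine j q σ (Prism.slice 0 s) = j (σ s) := by
  simp [straightLine, Prism.slice, Prism.proj]
  rfl

theorem straightLine_slice_one (j : X → V) (q : X → X) {n : ℕ} (σ : TopSimplex n → X)
    (s : TopSimplex n) : straightLine j q σ (Prism.slice 1 s) =
      ∑ i, s i • j (q (σ (TopSimplex.vertex i))) := by
  simp [straightLine, Prism.slice, Prism.proj]
  rfl

theorem straightLine_face (j : X → V) (q : X → X) {n : ℕ} (σ : TopSimplex (n + 1) → X)
    (i : Fin (n + 2)) (x : prism n) :
    straightLine j q σ (Prism.face i x) = straightLine j q (σ ∘ TopSimplex.face i) x := by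
  have h : ∀ k, TopSimplex.face i (TopSimplex.vertex k) = TopSimplex.vertex (i.succAbove k) :=
    fun k => stdSimplex.map_vertex (S := ℝ) i.succAbove k
  have := stdSimplex.sum_map_smul i.succAbove (Prism.proj n x)
    fun k => j (q (σ (TopSimplex.vertex k)))
  simp only [straightLine, Function.comp_apply, h, ← this]
  rfl

variable {E : Type*} [TopologicalSpace E]

/-- `h` lifts the retracted straight-line homotopy of `p ∘ σ`, starting from `σ`. -/
def IsStraightening (p : E → X) (j : X → V) (ρ : V → X) (q : X → X) {n : ℕ} (σ : C(TopSimplex n, E))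
    (h : C(prism n, E)) : Prop :=
  (∀ x, p (h x) = ρ (straightLine j q (p ∘ σ) x)) ∧ h.comp (Prism.slice 0) = σ

variable {p : E → X} {j : X → V} {ρ : V → X} {q : X → X}

theorem IsStraightening.face {n : ℕ} {σ : C(TopSimplex (n + 1), E)} {h : C(prism (n + 1), E)}
    (H : IsStraightening p j ρ q σ h) (i : Fin (n + 2)) :
    IsStraightening p j ρ q (σ.comp (TopSimplex.face i)) (h.comp (Prism.face i)) := by
  refine ⟨fun x => ?_, ?_⟩
  · rw [ContinuousMap.comp_apply, H.1, straightLine_face]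
    rfl
  · rw [← H.2]
    rfl

open Classical in
/-- A straightening of `σ`, if there is one. -/
def straightening (p : E → X) (j : X → V) (ρ : V → X) (q : X → X) {n : ℕ} (σ : C(TopSimplex n, E)) :
    C(prism n, E) :=
  if h : ∃ h, IsStraightening p j ρ q σ h then h.choose else σ.comp (Prism.proj n)

theorem isStraightening_straightening {n : ℕ} {σ : C(TopSimplex n, E)}
    (h : ∃ h, IsStraightening p j ρ q σ h) :
    IsStraightening p j ρ q σ (straightening p j ρ q σ) := by
  rw [straightening, dif_pos h]
  exact h.choose_spec

variable [MetricSpace X]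

theorem continuous_straightLine {j : X → V} (hj : Continuous j) (q : X → X) {n : ℕ}
    {σ : TopSimplex n → X} (hσ : Continuous σ) : Continuous (straightLine j q σ) := by
  unfold straightLine
  refine Continuous.add (by fun_prop) (Continuous.smul (by fun_prop) ?_)
  refine continuous_finsetSum _ fun i _ => Continuous.smul ?_ continuous_const
  exact (continuous_apply i).comp (continuous_subtype_val.comp (Prism.proj n).continuous)

/-- The points `j (σ s')` and the moved vertices lie within `δ / 4` and `δ / 2` of the center, and
balls are convex. -/
theorem straightLine_mem_ball {j : X → V} (hj : Isometry j) {q : X → X} {δ : ℝ} (hδ : 0 < δ)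
    (hq : ∀ x, dist (q x) x < δ / 4) {n : ℕ} {σ : TopSimplex n → X}
    (hσ : ∀ s s', dist (σ s) (σ s') ≤ δ / 4) (s : TopSimplex n) (x : prism n) :
    straightLine j q σ x ∈ Metric.ball (j (σ s)) δ := by
  have hb := convex_ball (j (σ s)) δ
  refine hb ?_ ?_ (sub_nonneg.2 x.2.1.2) x.2.1.1 (sub_add_cancel _ _)
  · rw [Metric.mem_ball, hj.dist_eq]
    linarith [hσ (Prism.proj n x) s]
  · refine hb.sum_mem (fun i _ => (Prism.proj n x).2.1 i) (Prism.proj n x).2.2 fun i _ => ?_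
    rw [Metric.mem_ball, hj.dist_eq]
    linarith [hσ (TopSimplex.vertex i) s, hq (σ (TopSimplex.vertex i)),
      dist_triangle (q (σ (TopSimplex.vertex i))) (σ (TopSimplex.vertex i)) (σ s)]

/-- Lifts on a connected prism that agree at a point are equal. Hence the arbitrary choice in
`straightening` is compatible with faces. -/
theorem IsStraightening.unique (hp : IsCoveringMap p) {n : ℕ} {σ : C(TopSimplex n, E)}
    {h h' : C(prism n, E)} (H : IsStraightening p j ρ q σ h) (H' : IsStraightening p j ρ q σ h') :
    h = h' := by
  refine DFunLike.coe_injective (hp.eq_of_comp_eq h.continuous h'.continuous ?_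
    (Prism.slice 0 (TopSimplex.vertex 0)) ?_)
  · funext x
    exact (H.1 x).trans (H'.1 x).symm
  · exact DFunLike.congr_fun (H.2.trans H'.2.symm) (TopSimplex.vertex 0)

/-- Homotopy lifting applies because `ρ ∘ j = id` makes the retracted homotopy start at `p ∘ σ`. -/
theorem IsStraightening.exists (hp : IsCoveringMap p) (hρj : ∀ x, ρ (j x) = x) {n : ℕ}
    {σ : C(TopSimplex n, E)} (hc : Continuous fun x => ρ (straightLine j q (p ∘ σ) x)) :
    ∃ h, IsStraightening p j ρ q σ h := by
  let F : C(unitInterval × TopSimplex n, X) :=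
    ⟨fun x => ρ (straightLine j q (p ∘ σ) (Prism.slice x.1 x.2)), hc.comp (by
      refine Continuous.subtype_mk ?_ _
      fun_prop)⟩
  have h0 : ∀ s, F (0, s) = p (σ s) := fun s => by
    change ρ (straightLine j q (p ∘ σ) (Prism.slice 0 s)) = _
    rw [straightLine_slice_zero, hρj]
    rfl
  refine ⟨(hp.liftHomotopy F σ h0).comp (Prism.toProd n), fun x => ?_, ?_⟩
  · exact congrFun (hp.liftHomotopy_lifts F σ h0) (Prism.toProd n x)
  · ext s
    exact hp.liftHomotopy_zero F σ h0 s

end Straightening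

/-! ### Maps into the sheets of a quotient covering -/

section Sheets

variable {E X A G : Type*} [TopologicalSpace E] [TopologicalSpace X] [TopologicalSpace A]
  [PreconnectedSpace A] [AddGroup G] [AddAction G E] {p : E → X}

/-- The translates of `N` are open, disjoint and cover the image of `γ`; connectedness of `A`
selects one of them. -/
theorem IsAddQuotientCoveringMap.exists_forall_mem_sheet (hp : IsAddQuotientCoveringMap p G)
    {N : Set E} (hN : IsOpen N) (hd : ∀ g : G, ((g +ᵥ ·) '' N ∩ N).Nonempty → g = 0) {γ : A → E}
    (hγ : Continuous γ) (h : ∀ a, p (γ a) ∈ p '' N) : ∃ g : G, ∀ a, ∃ n ∈ N, γ a = g +ᵥ n := by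
  rcases isEmpty_or_nonempty A with hA | ⟨⟨a₀⟩⟩
  · exact ⟨0, fun a => (hA.false a).elim⟩
  have := hp.toContinuousConstVAdd
  have hsheet : ∀ a, ∃ g : G, ∃ n ∈ N, γ a = g +ᵥ n := by
    intro a
    obtain ⟨n, hn, hna⟩ := h a
    obtain ⟨g, hg⟩ := hp.apply_eq_iff_mem_orbit.1 hna.symm
    exact ⟨g, n, hn, hg.symm⟩
  let S : G → Set A := fun g => {a | ∃ n ∈ N, γ a = g +ᵥ n}
  have hS : ∀ g, IsOpen (S g) := by
    intro g
    have : S g = (fun a => -g +ᵥ γ a) ⁻¹' N := by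
      ext a
      constructor
      · rintro ⟨n, hn, ha⟩
        simpa [ha] using hn
      · intro ha
        exact ⟨_, ha, by simp⟩
    rw [this]
    exact hN.preimage ((continuous_const_vadd _).comp hγ)
  obtain ⟨g, hg⟩ := hsheet a₀
  refine ⟨g, ?_⟩
  have hcl : IsClopen (S g) := by
    refine ⟨⟨?_⟩, hS g⟩
    have : (S g)ᶜ = ⋃ g' ∈ {g' | g' ≠ g}, S g' := by
      ext a
      simp only [Set.mem_compl_iff, Set.mem_iUnion, Set.mem_ofPred_eq, exists_prop]
      constructor
      · intro ha
        obtain ⟨g', hg'⟩ := hsheet a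
        exact ⟨g', fun e => ha (e ▸ hg'), hg'⟩
      · rintro ⟨g', hne, n', hn', ha'⟩ ⟨n, hn, ha⟩
        refine hne (neg_add_eq_zero.1 (hd (-g + g') ⟨n, ⟨n', hn', ?_⟩, hn⟩)).symm
        change (-g + g') +ᵥ n' = n
        rw [add_vadd, ← ha', ha, neg_vadd_vadd]
    rw [this]
    exact isOpen_biUnion fun g' _ => hS g'
  exact fun a => (hcl.eq_univ ⟨a₀, hg⟩ ▸ Set.mem_univ a : a ∈ S g)

end Sheets

/-! ### Finitely many simplices up to translation -/

theorem CompactSpace.exists_forall_dist_le {A X I : Type*} [PseudoMetricSpace A] [CompactSpace A]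
    [PseudoMetricSpace X] (S : Finset I) (φ : I → A → X) (hφ : ∀ i, Continuous (φ i)) {ε : ℝ}
    (hε : 0 < ε) : ∃ δ > 0, ∀ i ∈ S, ∀ a b, dist a b ≤ δ → dist (φ i a) (φ i b) ≤ ε := by
  have h : ∀ᶠ δ in 𝓝[>] (0 : ℝ), ∀ i ∈ S, ∀ a b, dist a b ≤ δ → dist (φ i a) (φ i b) ≤ ε := by
    rw [Filter.eventually_all_finset]
    intro i _
    obtain ⟨δ, hδ, h⟩ := Metric.uniformContinuous_iff.1
      (CompactSpace.uniformContinuous_of_continuous (hφ i)) ε hε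
    filter_upwards [Ioo_mem_nhdsGT hδ] with δ' hδ' a b hab
    exact (h (hab.trans_lt hδ'.2)).le
  obtain ⟨δ, h, hδ⟩ := (h.and self_mem_nhdsWithin).exists
  exact ⟨δ, hδ, h⟩

theorem Represents.exists_subdivision {κ Y : Type u} [Field κ] [TopologicalSpace Y] {r : ℕ}
    {z : SingularChain κ r Y} {y : Homology κ r Y} (hz : Represents z y) {δ : ℝ} (hδ : 0 < δ) :
    ∃ z' : SingularChain κ r Y, Represents z' y ∧ ∀ τ ∈ z'.support, ∃ σ ∈ z.support,
      ∃ u : C(TopSimplex r, prism r), (∀ s s', dist (u s) (u s') ≤ δ) ∧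
        τ = (σ.comp (Prism.proj r)).comp u := by
  obtain ⟨w, z', hw, h⟩ := SingularChain.exists_boundary_eq_subdivision z hz.isCycle hδ
  exact ⟨z', hz.of_boundary_eq hw, h⟩

section

variable {X E : Type u} [TopologicalSpace X] [TopologicalSpace E] {G : Type v} [AddCommGroup G]
  [AddAction G E] {p : E → X} {f : E → ℝ} {χ : G →+ ℝ}

/-- Every point has a neighborhood whose translates are disjoint and on which `f` varies by less
than `1`. -/
theorem IsAddQuotientCoveringMap.exists_sheet (hp : IsAddQuotientCoveringMap p G)
    (hf : Continuous f) (e : E) : ∃ N : Set E, IsOpen N ∧ e ∈ N ∧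
      (∀ g : G, ((g +ᵥ ·) '' N ∩ N).Nonempty → g = 0) ∧ ∀ x ∈ N, |f x - f e| < 1 := by
  obtain ⟨N, hN, hd⟩ := hp.disjoint e
  have h1 : {x | |f x - f e| < 1} ∈ 𝓝 e :=
    (isOpen_lt (by fun_prop) continuous_const).mem_nhds (by simp)
  obtain ⟨N', hN', ho, he⟩ := mem_nhds_iff.1 (Filter.inter_mem hN h1)
  refine ⟨N', ho, he, fun g hg => hd g (hg.mono ?_), fun x hx => (hN' hx).2⟩
  exact Set.inter_subset_inter (Set.image_mono fun x hx => (hN' hx).1) fun x hx => (hN' hx).1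

variable [ContinuousConstVAdd G E]

/-- A translation matching the two lifts at one vertex matches them on the whole connected simplex.
-/
theorem IsAddQuotientCoveringMap.eq_translation_comp (hp : IsAddQuotientCoveringMap p G) {n : ℕ}
    {σ τ : C(TopSimplex n, E)} (h : ∀ s, p (σ s) = p (τ s)) :
    ∃ g : G, τ = (translation G E g).comp σ := by
  obtain ⟨g, hg⟩ := hp.apply_eq_iff_mem_orbit.1 (h (TopSimplex.vertex 0)).symm
  refine ⟨g, ?_⟩
  have : PreconnectedSpace (TopSimplex n) :=
    Subtype.preconnectedSpace (convex_stdSimplex ℝ _).isPreconnected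
  refine DFunLike.coe_injective (hp.isCoveringMap.eq_of_comp_eq τ.continuous
    (ContinuousMap.continuous _) ?_ (TopSimplex.vertex 0) hg.symm)
  funext s
  exact ((h s).symm.trans (hp.apply_eq_iff_mem_orbit.2 ⟨g, rfl⟩).symm :)

/-- For a principal covering of a compact ANR, up to a bounded error in the values of `f` every
homology class is represented by a chain built from translates of finitely many simplices. -/
theorem IsAddQuotientCoveringMap.exists_finite_simplices (κ : Type u) [Field κ] [CompactSpace X]
    (hX : IsANR X) (hp : IsAddQuotientCoveringMap p G) (hf : Continuous f)
    (hχ : ∀ g e, f (g +ᵥ e) = f e + χ g) (r : ℕ) :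
    ∃ (Q : Type u) (_ : Finite Q) (L : Q → C(TopSimplex r, E)) (C : ℝ),
      ∀ (t : ℝ) (z : SingularChain κ r E) (y : Homology κ r E), Represents z y →
        (∀ σ ∈ z.support, ∀ s, f (σ s) ≤ t) →
        ∃ z' : SingularChain κ r E, Represents z' y ∧ ∀ τ ∈ z'.support, ∃ (q : Q) (g : G),
          τ = (translation G E g).comp (L q) ∧ f (L q (TopSimplex.vertex 0)) + χ g ≤ t + C := by
  rcases isEmpty_or_nonempty X with hXe | hXn
  · refine ⟨PEmpty, inferInstance, PEmpty.elim, 0, fun t z y hz _ => ⟨z, hz, fun τ _ => ?_⟩⟩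
    exact (hXe.false (p (τ (TopSimplex.vertex 0)))).elim
  have := hX.metrizable
  let : MetricSpace X := TopologicalSpace.metrizableSpaceMetric X
  choose N hNo heN hNd hNf using fun e => hp.exists_sheet hf e
  obtain ⟨j, ρ, δ, hj, hδ, hρj, hball⟩ := hX.exists_controlled_retraction (fun e => p '' N e)
    (fun e => hp.isCoveringMap.isOpenMap _ (hNo e)) fun x => by
      obtain ⟨e, rfl⟩ := hp.surjective x
      exact ⟨e, e, heN e, rfl⟩
  obtain ⟨T, -, hTf, hT⟩ := finite_cover_balls_of_compact (isCompact_univ (X := X))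
    (e := δ / 4) (by positivity)
  have hq : ∀ x, ∃ y : T, dist (y : X) x < δ / 4 := by
    intro x
    obtain ⟨y, hy, hxy⟩ := Set.mem_iUnion₂.1 (hT (Set.mem_univ x))
    exact ⟨⟨y, hy⟩, by rw [dist_comm]; exact hxy⟩
  choose q hq using hq
  let q' : X → X := fun x => q x
  -- the key properties of small simplices
  have hsmall : ∀ {n : ℕ} (σ : C(TopSimplex n, E)), (∀ s s', dist (p (σ s)) (p (σ s')) ≤ δ / 4) →
      IsStraightening p j ρ q' σ (straightening p j ρ q' σ) ∧
      ∀ x x', f (straightening p j ρ q' σ x) ≤ f (straightening p j ρ q' σ x') + 2 := by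
    intro n σ hσ
    have hmem := fun x => straightLine_mem_ball hj hδ hq (σ := p ∘ σ) hσ (TopSimplex.vertex 0) x
    obtain ⟨e, hc, hm⟩ := hball (p (σ (TopSimplex.vertex 0)))
    have hst : IsStraightening p j ρ q' σ (straightening p j ρ q' σ) := by
      refine isStraightening_straightening (IsStraightening.exists hp.isCoveringMap hρj ?_)
      exact hc.comp_continuous (continuous_straightLine hj.continuous q'
        (hp.continuous.comp σ.continuous)) hmem
    refine ⟨hst, fun x x' => ?_⟩
    -- The whole homotopy lies in one translate of `N e`, where `f` is within 1 of `f e + χ g`;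
    -- hence the bound 2.
    obtain ⟨g, hg⟩ := hp.exists_forall_mem_sheet (hNo e) (hNd e)
      (straightening p j ρ q' σ).continuous fun x => by
        rw [hst.1]
        exact hm (hmem x)
    obtain ⟨a, ha, hxa⟩ := hg x
    obtain ⟨b, hb, hxb⟩ := hg x'
    rw [hxa, hxb, hχ, hχ]
    have h1 := abs_lt.1 (hNf e a ha)
    have h2 := abs_lt.1 (hNf e b hb)
    linarith
  have : Finite T := hTf
  -- After straightening, the projection of a simplex depends only on its vertices in the finite
  -- net. `Q` indexes the vertex tuples whose simplex lifts, and one lift of each is chosen.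
  let Q : Type u := {v : Fin (r + 1) → T //
    ∃ τ : C(TopSimplex r, E), ∀ s, p (τ s) = ρ (∑ i, s i • j (v i))}
  refine ⟨Q, inferInstance, fun v => v.2.choose, 2, fun t z y hz hzt => ?_⟩
  -- Only this mesh depends on the cycle. `Q`, the lifts and the constant 2 are fixed beforehand,
  -- hence uniform in `t`.
  obtain ⟨η, hη, hsm⟩ := CompactSpace.exists_forall_dist_le z.support
    (fun σ x => p (σ (Prism.proj r x))) (fun σ => hp.continuous.comp (by fun_prop))
    (ε := δ / 4) (by positivity)
  obtain ⟨z₁, hz₁, hsub⟩ := hz.exists_subdivision hη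
  have hsm₁ : ∀ τ ∈ z₁.support, (∀ s s', dist (p (τ s)) (p (τ s')) ≤ δ / 4) ∧
      ∀ s, f (τ s) ≤ t := by
    intro τ hτ
    obtain ⟨σ, hσ, u, hu, rfl⟩ := hsub τ hτ
    exact ⟨fun s s' => hsm σ hσ _ _ (hu s s'), fun s => hzt σ hσ _⟩
  obtain ⟨w, hw⟩ := SingularChain.exists_boundary_eq_of_homotopy
    (fun n σ => straightening p j ρ q' σ) z₁ hz₁.isCycle
    (fun σ hσ => (hsmall σ (hsm₁ σ hσ).1).1.2) (by
      rintro m σ rfl hσ i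
      have hs := (hsm₁ σ hσ).1
      exact IsStraightening.unique hp.isCoveringMap
        (hsmall (σ.comp (TopSimplex.face i)) fun s s' => hs _ _).1 ((hsmall σ hs).1.face i))
  refine ⟨_, hz₁.of_boundary_eq hw, fun τ hτ => ?_⟩
  classical
  obtain ⟨σ, hσ, rfl⟩ := Finset.mem_image.1 (Finsupp.mapDomain_support hτ)
  obtain ⟨hs, ht⟩ := hsm₁ σ hσ
  obtain ⟨hst, hbd⟩ := hsmall σ hs
  have htop : ∀ s, p (straightening p j ρ q' σ (Prism.slice 1 s)) =
      ρ (∑ i, s i • j (q (p (σ (TopSimplex.vertex i))))) := by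
    intro s
    rw [hst.1, straightLine_slice_one]
    rfl
  let v : Q := ⟨fun i => q (p (σ (TopSimplex.vertex i))),
    (straightening p j ρ q' σ).comp (Prism.slice 1), htop⟩
  obtain ⟨g, hg⟩ := hp.eq_translation_comp (σ := v.2.choose)
    (τ := (straightening p j ρ q' σ).comp (Prism.slice 1))
    fun s => (v.2.choose_spec s).trans (htop s).symm
  refine ⟨v, g, hg, ?_⟩
  have h1 := hbd (Prism.slice 1 (TopSimplex.vertex 0)) (Prism.slice 0 (TopSimplex.vertex 0))
  have h2 : straightening p j ρ q' σ (Prism.slice 0 (TopSimplex.vertex 0)) =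
    σ (TopSimplex.vertex 0) := DFunLike.congr_fun hst.2 _
  have h3 : straightening p j ρ q' σ (Prism.slice 1 (TopSimplex.vertex 0)) =
    g +ᵥ v.2.choose (TopSimplex.vertex 0) := DFunLike.congr_fun hg _
  rw [h2, h3, hχ] at h1
  linarith [ht (TopSimplex.vertex 0)]

end

/-! ### The degree filtration of a group ring -/

namespace AddMonoidAlgebra

variable {κ : Type*} [Field κ] {G : Type*} [AddCommGroup G] (χ : G →+ ℝ)

/-- The elements of the group ring supported in `{g | χ g ≤ s}`. -/
def degreeLE (κ : Type*) [Field κ] (s : ℝ) : Submodule κ (AddMonoidAlgebra κ G) where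
  carrier := {a | ∀ g, a.coeff g ≠ 0 → χ g ≤ s}
  zero_mem' := fun g hg => (hg rfl).elim
  add_mem' := by
    intro a b ha hb g hg
    by_contra h
    have h1 : a.coeff g = 0 := by_contra fun h' => h (ha g h')
    have h2 : b.coeff g = 0 := by_contra fun h' => h (hb g h')
    exact hg (by rw [coeff_add, Finsupp.add_apply, h1, h2, add_zero])
  smul_mem' := by
    intro k a ha g hg
    refine ha g fun h => hg ?_
    rw [coeff_smul_apply, h, smul_zero]

variable {χ}

theorem single_mem_degreeLE {g : G} {a : κ} {s : ℝ} (h : χ g ≤ s) :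
    (single g a : AddMonoidAlgebra κ G) ∈ degreeLE χ κ s := by
  classical
  intro g' hg'
  rw [coeff_single, Finsupp.single_apply] at hg'
  split_ifs at hg' with e
  · exact e ▸ h
  · exact (hg' rfl).elim

theorem eq_sum_single {G : Type*} (a : AddMonoidAlgebra κ G) :
    a = ∑ g ∈ a.coeff.support, single g (a.coeff g) :=
  a.sum_coeff_single.symm

theorem mul_mem_degreeLE {a b : AddMonoidAlgebra κ G} {s t : ℝ} (ha : a ∈ degreeLE χ κ s)
    (hb : b ∈ degreeLE χ κ t) : a * b ∈ degreeLE χ κ (s + t) := by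
  rw [eq_sum_single a, Finset.sum_mul]
  refine Submodule.sum_mem _ fun g hg g' hg' => ?_
  have h1 := ha g (Finsupp.mem_support_iff.1 hg)
  rw [coeff_single_mul_apply] at hg'
  have h2 := hb _ (right_ne_zero_of_mul hg')
  rw [map_add, map_neg] at h2
  linarith

theorem exists_mem_degreeLE {Q : Type*} [Finite Q] (m : Q → AddMonoidAlgebra κ G) :
    ∃ D : ℝ, ∀ q, m q ∈ degreeLE χ κ D := by
  have : ∀ᶠ D : ℝ in Filter.atTop, ∀ q, m q ∈ degreeLE χ κ D := by
    rw [Filter.eventually_all]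
    intro q
    have : ∀ᶠ D : ℝ in Filter.atTop, ∀ g ∈ (m q).coeff.support, χ g ≤ D := by
      rw [Filter.eventually_all_finset]
      exact fun g _ => Filter.eventually_ge_atTop _
    filter_upwards [this] with D hD g hg
    exact hD g (Finsupp.mem_support_iff.2 hg)
  exact this.exists

theorem eq_zero_of_forall_mem_degreeLE {a : AddMonoidAlgebra κ G}
    (h : ∀ s, a ∈ degreeLE χ κ s) : a = 0 := by
  by_contra ha
  obtain ⟨g, hg⟩ : ∃ g, a.coeff g ≠ 0 := by
    by_contra! h'
    exact ha (by ext g; simpa using h' g)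
  linarith [h (χ g - 1) g hg]

end AddMonoidAlgebra

/-! ### Torsion modulo a submodule of a free module -/

/-- Clearing denominators: a nonzero element of `R` carries any vector of the span into the image of
`B`. -/
theorem Submodule.exists_smul_mem_of_mem_span_fractionRing {R Q : Type*} [CommRing R] [IsDomain R]
    (B : Submodule R (Q → R)) (c : Q → R)
    (hc : (fun q => algebraMap R (FractionRing R) (c q)) ∈ Submodule.span (FractionRing R)
      ((fun (b : Q → R) q => algebraMap R (FractionRing R) (b q)) '' B)) :
    ∃ a : R, a ≠ 0 ∧ a • c ∈ B := by
  have key : ∀ x ∈ Submodule.span (FractionRing R)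
      ((fun (b : Q → R) q => algebraMap R (FractionRing R) (b q)) '' B),
      ∃ a : R, a ≠ 0 ∧ ∃ b ∈ B, ∀ q, algebraMap R (FractionRing R) a * x q =
        algebraMap R (FractionRing R) (b q) := by
    intro x hx
    induction hx using Submodule.span_induction with
    | mem x hx =>
      obtain ⟨b, hb, rfl⟩ := hx
      exact ⟨1, one_ne_zero, b, hb, fun q => by simp⟩
    | zero => exact ⟨1, one_ne_zero, 0, B.zero_mem, fun q => by simp⟩
    | add x y _ _ hx hy =>
      obtain ⟨a, ha, b, hb, hab⟩ := hx
      obtain ⟨a', ha', b', hb', hab'⟩ := hy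
      refine ⟨a * a', mul_ne_zero ha ha', a' • b + a • b',
        B.add_mem (B.smul_mem _ hb) (B.smul_mem _ hb'), fun q => ?_⟩
      simp only [Pi.add_apply, Pi.smul_apply, smul_eq_mul, map_add, map_mul, ← hab, ← hab']
      ring
    | smul k x _ hx =>
      obtain ⟨a, ha, b, hb, hab⟩ := hx
      obtain ⟨n, d, hd, rfl⟩ := IsFractionRing.div_surjective (A := R) k
      have hd0 := nonZeroDivisors.ne_zero hd
      have hd' : algebraMap R (FractionRing R) d ≠ 0 := by
        simpa using hd0
      refine ⟨a * d, mul_ne_zero ha hd0, n • b, B.smul_mem _ hb, fun q => ?_⟩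
      simp only [Pi.smul_apply, smul_eq_mul, map_mul, ← hab]
      field_simp
  obtain ⟨a, ha, b, hb, h⟩ := key _ hc
  refine ⟨a, ha, ?_⟩
  convert hb using 1
  funext q
  refine IsFractionRing.injective R (FractionRing R) ?_
  rw [← h q, Pi.smul_apply, smul_eq_mul, map_mul]

theorem Submodule.exists_dual_of_forall_smul_notMem {R Q : Type*} [CommRing R] [IsDomain R]
    [Fintype Q] (B : Submodule R (Q → R)) (c : Q → R) (hc : ∀ a : R, a ≠ 0 → a • c ∉ B) :
    ∃ m : Q → R, (∀ b ∈ B, ∑ q, b q * m q = 0) ∧ ∑ q, c q * m q ≠ 0 := by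
  classical
  let K := FractionRing R
  let i : (Q → R) → Q → K := fun b q => algebraMap R K (b q)
  have hn : i c ∉ Submodule.span K (i '' B) := fun h => by
    obtain ⟨a, ha, hac⟩ := Submodule.exists_smul_mem_of_mem_span_fractionRing B c h
    exact hc a ha hac
  obtain ⟨l, hl, hker⟩ := Submodule.exists_le_ker_of_notMem hn
  -- A functional over the fraction field separates `c` from `B`; a common denominator of its
  -- coefficients brings it back to `R`.
  obtain ⟨d, hd⟩ := IsLocalization.exist_integer_multiples_of_finite (nonZeroDivisors R)
    fun q => l (Pi.single q 1)
  choose m hm using hd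
  have hsum : ∀ b, algebraMap R K (∑ q, b q * m q) = algebraMap R K d * l (i b) := by
    intro b
    have : l (i b) = ∑ q, i b q * l (Pi.single q 1) := by
      conv_lhs => rw [← Finset.univ_sum_single (i b), map_sum]
      refine Finset.sum_congr rfl fun q _ => ?_
      rw [← smul_eq_mul, ← map_smul, ← Pi.single_smul, smul_eq_mul, mul_one]
    rw [this, map_sum, Finset.mul_sum]
    refine Finset.sum_congr rfl fun q _ => ?_
    rw [map_mul, hm, Algebra.smul_def]
    ring
  have hd0 : algebraMap R K d ≠ 0 := by
    simp
  refine ⟨m, fun b hb => ?_, fun h => ?_⟩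
  · refine IsFractionRing.injective R K ?_
    rw [hsum, map_zero, LinearMap.mem_ker.1 (hker (Submodule.subset_span ⟨b, hb, rfl⟩)), mul_zero]
  · have := hsum c
    rw [h, map_zero] at this
    exact mul_ne_zero hd0 hl this.symm

/-- An element of a finite free module over a group ring that is congruent, modulo a submodule, to
elements of arbitrarily negative degree is torsion modulo that submodule. -/
theorem AddMonoidAlgebra.exists_smul_mem_of_forall_degreeLE {κ G Q : Type*} [Field κ]
    [AddCommGroup G] [IsDomain (AddMonoidAlgebra κ G)] [Finite Q] (χ : G →+ ℝ)
    (B : Submodule (AddMonoidAlgebra κ G) (Q → AddMonoidAlgebra κ G))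
    (c : Q → AddMonoidAlgebra κ G)
    (h : ∀ t, ∃ c', c - c' ∈ B ∧ ∀ q, c' q ∈ degreeLE χ κ t) :
    ∃ a : AddMonoidAlgebra κ G, a ≠ 0 ∧ a • c ∈ B := by
  have := Fintype.ofFinite Q
  by_contra! hc
  obtain ⟨m, hB, hm⟩ := Submodule.exists_dual_of_forall_smul_notMem B c hc
  obtain ⟨D, hD⟩ := exists_mem_degreeLE (χ := χ) m
  refine hm (eq_zero_of_forall_mem_degreeLE (χ := χ) fun s => ?_)
  -- The functional agrees on `c` and `c'`, and raises degrees by at most `D`, so its value has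
  -- degree at most `s`.
  obtain ⟨c', hc', hdeg⟩ := h (s - D)
  have h0 := hB _ hc'
  simp only [Pi.sub_apply, sub_mul, Finset.sum_sub_distrib, sub_eq_zero] at h0
  rw [h0]
  refine Submodule.sum_mem _ fun q _ => ?_
  simpa using mul_mem_degreeLE (hdeg q) (hD q)

/-! ### Chains built from translates of finitely many simplices -/

section Translates

variable {κ E : Type u} [Field κ] [TopologicalSpace E] {G : Type v} [AddCommGroup G]
  [AddAction G E] [ContinuousConstVAdd G E] {r : ℕ} {Q : Type*} [Fintype Q]

/-- The chain `∑ q, c q • L q`. -/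
def translatesChain (κ : Type u) [Field κ] (G : Type v) [AddCommGroup G] [AddAction G E]
    [ContinuousConstVAdd G E] (L : Q → C(TopSimplex r, E)) :
    (Q → AddMonoidAlgebra κ G) →ₗ[κ] SingularChain κ r E :=
  ∑ q, Finsupp.lmapDomain κ κ (fun g => (translation G E g).comp (L q)) ∘ₗ
    (AddMonoidAlgebra.coeffLinearEquiv κ).toLinearMap ∘ₗ LinearMap.proj q

theorem translatesChain_apply (L : Q → C(TopSimplex r, E)) (c : Q → AddMonoidAlgebra κ G) :
    translatesChain κ G L c = ∑ q, Finsupp.mapDomain (fun g => (translation G E g).comp (L q))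
      (c q).coeff := by
  simp [translatesChain]

theorem translatesChain_single_smul (L : Q → C(TopSimplex r, E)) (c : Q → AddMonoidAlgebra κ G)
    (g : G) (a : κ) :
    translatesChain κ G L ((AddMonoidAlgebra.single g a : AddMonoidAlgebra κ G) • c) =
      a • SingularChain.map κ (translation G E g) r (translatesChain κ G L c) := by
  rw [translatesChain_apply, translatesChain_apply, map_sum, Finset.smul_sum]
  refine Finset.sum_congr rfl fun q _ => ?_
  rw [Pi.smul_apply, smul_eq_mul]
  induction c q using AddMonoidAlgebra.induction_linear with
  | zero => simp
  | add x y hx hy =>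
    rw [mul_add, AddMonoidAlgebra.coeff_add, Finsupp.mapDomain_add, hx, hy,
      AddMonoidAlgebra.coeff_add, Finsupp.mapDomain_add, map_add, smul_add]
  | single h b =>
    rw [AddMonoidAlgebra.single_mul_single, AddMonoidAlgebra.coeff_single,
      AddMonoidAlgebra.coeff_single, Finsupp.mapDomain_single, Finsupp.mapDomain_single,
      SingularChain.map_single, Finsupp.smul_single, smul_eq_mul]
    congr 1
    ext s
    exact add_vadd g h _

theorem Represents.smul_translatesChain {L : Q → C(TopSimplex r, E)}
    {c : Q → AddMonoidAlgebra κ G} {y : Homology κ r E}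
    (h : Represents (translatesChain κ G L c) y) (a : AddMonoidAlgebra κ G) :
    Represents (translatesChain κ G L (a • c)) (a • y) := by
  induction a using AddMonoidAlgebra.induction_linear with
  | zero =>
    rw [zero_smul, zero_smul, map_zero]
    exact Represents.zero
  | add a b ha hb =>
    rw [add_smul, add_smul, map_add]
    exact ha.add hb
  | single g k =>
    rw [translatesChain_single_smul, homologyModule_single_smul]
    exact (h.map _).smul k

end Translates

/-! ### Torsion and sublevel sets -/

section Torsion

variable {κ E : Type u} [Field κ] [TopologicalSpace E] {G : Type v} [AddCommGroup G]
  [AddAction G E] [ContinuousConstVAdd G E] {f : E → ℝ} {χ : G →+ ℝ} {r : ℕ}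

theorem sublevelImage_mono {s t : ℝ} (h : s ≤ t) :
    sublevelImage κ r f s ≤ sublevelImage κ r f t := by
  intro y hy
  obtain ⟨z, hz, hzs⟩ := mem_homologyImage_iff.1 hy
  exact mem_homologyImage_iff.2 ⟨z, hz, fun σ hσ s => (hzs σ hσ s).trans h⟩

theorem exists_mem_sublevelImage (hf : Continuous f) (y : Homology κ r E) :
    ∃ s, y ∈ sublevelImage κ r f s := by
  obtain ⟨z, hz⟩ := Represents.exists_chain y
  have h : ∀ᶠ s : ℝ in Filter.atTop, ∀ σ ∈ z.support, ∀ x, f (σ x) ≤ s := by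
    rw [Filter.eventually_all_finset]
    intro σ _
    obtain ⟨M, hM⟩ := (isCompact_range (hf.comp σ.continuous)).bddAbove
    filter_upwards [Filter.eventually_ge_atTop M] with s hs x
    exact (hM ⟨x, rfl⟩).trans hs
  obtain ⟨s, hs⟩ := h.exists
  exact ⟨s, mem_homologyImage_iff.2 ⟨z, hz, hs⟩⟩

theorem smul_mem_sublevelImage (hχ : ∀ (g : G) e, f (g +ᵥ e) = f e + χ g)
    {a : AddMonoidAlgebra κ G} {s t : ℝ} (ha : a ∈ AddMonoidAlgebra.degreeLE χ κ s)
    {y : Homology κ r E} (hy : y ∈ sublevelImage κ r f t) :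
    a • y ∈ sublevelImage κ r f (s + t) := by
  classical
  rw [AddMonoidAlgebra.eq_sum_single a, Finset.sum_smul]
  refine Submodule.sum_mem _ fun g hg => ?_
  rw [homologyModule_single_smul]
  refine Submodule.smul_mem _ _ ?_
  obtain ⟨z, hz, hzt⟩ := mem_homologyImage_iff.1 hy
  refine mem_homologyImage_iff.2 ⟨_, hz.map _, fun σ hσ x => ?_⟩
  obtain ⟨τ, hτ, rfl⟩ := Finset.mem_image.1 (Finsupp.mapDomain_support hσ)
  have h1 := ha g (Finsupp.mem_support_iff.1 hg)
  have h2 : f (τ x) ≤ t := hzt τ hτ x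
  change f (g +ᵥ τ x) ≤ s + t
  rw [hχ]
  linarith

theorem mem_sublevelImage_of_smul_eq_zero (hf : Continuous f)
    (hχ : ∀ (g : G) e, f (g +ᵥ e) = f e + χ g) (hinj : Function.Injective χ)
    {a : AddMonoidAlgebra κ G} (ha : a ≠ 0) {y : Homology κ r E} (hy : a • y = 0) (t : ℝ) :
    y ∈ sublevelImage κ r f t := by
  have hsupp : a.coeff.support.Nonempty := by
    rw [Finset.nonempty_iff_ne_empty, Ne, Finsupp.support_eq_empty]
    exact fun h => ha (by ext g; simp [h])
  obtain ⟨g₀, hg₀, hmax⟩ := a.coeff.support.exists_max_image χ hsupp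
  have ha₀ : a.coeff g₀ ≠ 0 := Finsupp.mem_support_iff.1 hg₀
  -- Injectivity of `χ` makes the leading term unique, and finiteness of the support leaves a gap
  -- below it.
  obtain ⟨ε, hε, hgap⟩ : ∃ ε > 0, a.erase g₀ ∈ AddMonoidAlgebra.degreeLE χ κ (χ g₀ - ε) := by
    have h : ∀ᶠ ε in 𝓝[>] (0 : ℝ), ∀ g ∈ a.coeff.support, g ≠ g₀ → χ g ≤ χ g₀ - ε := by
      rw [Filter.eventually_all_finset]
      intro g hg
      rcases eq_or_ne g g₀ with rfl | hne
      · exact Filter.Eventually.of_forall fun _ h => (h rfl).elim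
      · have hlt : χ g < χ g₀ := lt_of_le_of_ne (hmax g hg) (hinj.ne hne)
        filter_upwards [Ioo_mem_nhdsGT (sub_pos.2 hlt)] with ε hε _
        linarith [hε.2]
    obtain ⟨ε, h, hε⟩ := (h.and self_mem_nhdsWithin).exists
    refine ⟨ε, hε, fun g hg => ?_⟩
    rw [AddMonoidAlgebra.coeff_erase] at hg
    rcases eq_or_ne g g₀ with rfl | hne
    · simp at hg
    · rw [Finsupp.erase_ne hne] at hg
      exact h g (Finsupp.mem_support_iff.2 hg) hne
  have step : ∀ s, y ∈ sublevelImage κ r f s → y ∈ sublevelImage κ r f (s - ε) := by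
    intro s hs
    have h1 : (AddMonoidAlgebra.single g₀ (a.coeff g₀) : AddMonoidAlgebra κ G) • y =
        -(a.erase g₀ • y) := by
      rw [eq_neg_iff_add_eq_zero, ← add_smul, AddMonoidAlgebra.single_add_erase, hy]
    -- The leading term is a unit; its inverse lowers levels by `χ g₀`, while the remaining terms
    -- raise them by at most `χ g₀ - ε`.
    have h2 : y = (AddMonoidAlgebra.single (-g₀) (a.coeff g₀)⁻¹ : AddMonoidAlgebra κ G) •
        -(a.erase g₀ • y) := by
      rw [← h1, ← mul_smul, AddMonoidAlgebra.single_mul_single, neg_add_cancel,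
        inv_mul_cancel₀ ha₀, ← AddMonoidAlgebra.one_def, one_smul]
    rw [h2]
    refine sublevelImage_mono ?_ (smul_mem_sublevelImage hχ
      (AddMonoidAlgebra.single_mem_degreeLE (s := -χ g₀) (map_neg χ g₀).le)
      (Submodule.neg_mem _ (smul_mem_sublevelImage hχ hgap hs)))
    linarith
  obtain ⟨s, hs⟩ := exists_mem_sublevelImage hf y
  have hn : ∀ n : ℕ, y ∈ sublevelImage κ r f (s - n * ε) := by
    intro n
    induction n with
    | zero => simpa using hs
    | succ n ih =>
      have := step _ ih
      push_cast
      rwa [add_mul, one_mul, ← sub_sub]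
  obtain ⟨n, hn'⟩ := exists_nat_ge ((s - t) / ε)
  refine sublevelImage_mono ?_ (hn n)
  rw [div_le_iff₀ hε] at hn'
  linarith

variable {X : Type u} [TopologicalSpace X] [CompactSpace X] {p : E → X}

theorem exists_smul_eq_zero_of_forall_mem_sublevelImage [IsDomain (AddMonoidAlgebra κ G)]
    (hX : IsANR X) (hp : IsAddQuotientCoveringMap p G) (hf : Continuous f)
    (hχ : ∀ (g : G) e, f (g +ᵥ e) = f e + χ g) {y : Homology κ r E}
    (hy : ∀ t, y ∈ sublevelImage κ r f t) :
    ∃ a : AddMonoidAlgebra κ G, a ≠ 0 ∧ a • y = 0 := by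
  obtain ⟨Q, hQ, L, C, hL⟩ := hp.exists_finite_simplices κ hX hf hχ r
  have := Fintype.ofFinite Q
  obtain ⟨D, hD⟩ : ∃ D, ∀ q, D ≤ f (L q (TopSimplex.vertex 0)) :=
    (Set.finite_range fun q => f (L q (TopSimplex.vertex 0))).bddBelow.imp
      fun D h q => h ⟨q, rfl⟩
  have hrep : ∀ t, ∃ c : Q → AddMonoidAlgebra κ G, Represents (translatesChain κ G L c) y ∧
      ∀ q, c q ∈ AddMonoidAlgebra.degreeLE χ κ t := by
    intro t
    -- The shift absorbs the error `C` and the lower bound `D` of `f` at the base vertices, leaving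
    -- `χ g ≤ t` for every translate used.
    obtain ⟨z, hz, hzt⟩ := mem_homologyImage_iff.1 (hy (t + D - C))
    obtain ⟨z', hz', hsupp⟩ := hL _ z y hz hzt
    let N : Submodule κ (SingularChain κ r E) :=
      (Submodule.pi Set.univ fun _ : Q => AddMonoidAlgebra.degreeLE χ κ t).map
        (translatesChain κ G L)
    have hmem : z' ∈ N := by
      refine Finsupp.map_mem_of_mem_supported LinearMap.id N ?_
        ((Finsupp.mem_supported κ z').2 (Set.Subset.refl _))
      intro τ hτ
      obtain ⟨q, g, rfl, hg⟩ := hsupp τ hτ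
      classical
      refine ⟨Pi.single q (AddMonoidAlgebra.single g 1), fun q' _ => ?_, ?_⟩
      · rcases eq_or_ne q' q with rfl | hne
        · rw [Pi.single_eq_same]
          exact AddMonoidAlgebra.single_mem_degreeLE (by linarith [hD q'])
        · rw [Pi.single_eq_of_ne hne]
          exact Submodule.zero_mem _
      · rw [translatesChain_apply, Finset.sum_eq_single q]
        · rw [Pi.single_eq_same, AddMonoidAlgebra.coeff_single, Finsupp.mapDomain_single]
          rfl
        · intro q' _ hne
          rw [Pi.single_eq_of_ne hne]
          exact Finsupp.mapDomain_zero
        · exact fun h => (h (Finset.mem_univ q)).elim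
    obtain ⟨c, hc, rfl⟩ := hmem
    exact ⟨c, hz', fun q => hc q trivial⟩
  -- The relations in homology among translates of the `L q`.
  let B : Submodule (AddMonoidAlgebra κ G) (Q → AddMonoidAlgebra κ G) :=
    { carrier := {c | Represents (translatesChain κ G L c) 0}
      zero_mem' := by
        change Represents _ _
        rw [map_zero]
        exact Represents.zero
      add_mem' := by
        intro b c hb hc
        have := Represents.add hb hc
        rwa [← map_add, add_zero] at this
      smul_mem' := by
        intro a c hc
        have := Represents.smul_translatesChain hc a
        rwa [smul_zero] at this }
  -- Any level would do here: representatives at different levels differ by elements of `B`.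
  obtain ⟨c, hc, -⟩ := hrep 0
  obtain ⟨a, ha, hac⟩ := AddMonoidAlgebra.exists_smul_mem_of_forall_degreeLE χ B c fun t => by
    obtain ⟨c', hc', hdeg⟩ := hrep t
    refine ⟨c', ?_, hdeg⟩
    have := hc.sub hc'
    rwa [← map_sub, sub_self] at this
  exact ⟨a, ha, (hc.smul_translatesChain a).unique hac⟩

theorem torsion_eq_iInter_sublevelImage [IsDomain (AddMonoidAlgebra κ G)]
    (hX : IsANR X) (hp : IsAddQuotientCoveringMap p G) (hf : Continuous f)
    (hχ : ∀ (g : G) e, f (g +ᵥ e) = f e + χ g) (hinj : Function.Injective χ) (r : ℕ) :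
    (Submodule.torsion (AddMonoidAlgebra κ G) (Homology κ r E) : Set (Homology κ r E)) =
      ⋂ t : ℝ, (sublevelImage κ r f t : Set (Homology κ r E)) := by
  ext y
  rw [Set.mem_iInter, SetLike.mem_coe, Submodule.mem_torsion_iff]
  constructor
  · rintro ⟨a, ha⟩
    exact mem_sublevelImage_of_smul_eq_zero hf hχ hinj (nonZeroDivisors.ne_zero a.2) ha
  · intro h
    obtain ⟨a, ha, hay⟩ := exists_smul_eq_zero_of_forall_mem_sublevelImage hX hp hf hχ h
    exact ⟨⟨a, mem_nonZeroDivisors_of_ne_zero ha⟩, hay⟩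

end Torsion

/-! ### The theorem for closed one-forms -/

theorem proposition3p1 {X E κ : Type u} [TopologicalSpace X] [CompactSpace X] (hX : IsANR X)
    [Field κ] (ω : TC1Form X) [TopologicalSpace E] [AddAction ω.periods E]
    [ContinuousConstVAdd ω.periods E] (p : C(E, X)) (hp : ω.IsAssociatedCovering p)
    (f : E → ℝ) (hf : ω.IsLift p f) (r : ℕ) :
    (Submodule.torsion (AddMonoidAlgebra κ ω.periods) (Homology κ r E) : Set (Homology κ r E)) =
        ⋂ t : ℝ, (sublevelImage κ r f t : Set (Homology κ r E)) ∧
      (Submodule.torsion (AddMonoidAlgebra κ ω.periods) (Homology κ r E) : Set (Homology κ r E)) =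
        ⋂ t : ℝ, (superlevelImage κ r f t : Set (Homology κ r E)) := by
  have hinj : Function.Injective ω.periods.subtype := Subtype.val_injective
  refine ⟨torsion_eq_iInter_sublevelImage hX hp.isAddQuotientCoveringMap hf.continuous
    (χ := ω.periods.subtype) (fun g e => hf.equivariant g e) hinj r, ?_⟩
  have hsup : ∀ t, superlevelImage κ r f t = sublevelImage κ r (fun e => -f e) (-t) := by
    intro t
    simp only [superlevelImage, sublevelImage, neg_le_neg_iff]
  rw [torsion_eq_iInter_sublevelImage (f := fun e => -f e) (χ := -ω.periods.subtype) hX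
    hp.isAddQuotientCoveringMap hf.continuous.neg
    (fun g e => by rw [hf.equivariant, neg_add]; rfl) (neg_injective.comp hinj) r]
  simp only [hsup]
  -- Reindexing the intersection by `t ↦ -t`.
  exact (neg_surjective.iInter_comp fun t : ℝ =>
    (sublevelImage κ r (fun e => -f e) t : Set (Homology κ r E))).symm

end
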